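/- Let $E\subset\mathbb{C}$ be a totally disconnected compact set with positive area (two-dimensional Lebesgue measure). Then there exists a homeomorphism $f\colon\mathbb{C}\to\mathbb{C}$ (onto $\mathbb C$) that is conformal in $\mathbb{C}\setminus E$, i.e., $f$ is holomorphic and injective with nowhere vanishing derivative in $\mathbb{C}\setminus E$, but $f$ is not a Möbius transformation, i.e., $f$ is not the restriction to $\mathbb{C}$ of a map $z\mapsto \frac{az+b}{cz+d}$ of the Riemann sphere with $a,b,c,d\in\mathbb{C}$ and $ad-bc\neq 0$. -/

import Mathlib

/-- A complex function is conformal on an open set `U` if it is holomorphic and injective on `U`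
and its derivative has no zero there; that is, it is a biholomorphic map of `U` onto its image. -/
structure IsConformalOn (f : ℂ → ℂ) (U : Set ℂ) : Prop where
  differentiableOn : DifferentiableOn ℂ f U
  injOn : Set.InjOn f U
  deriv_ne_zero : ∀ z ∈ U, deriv f z ≠ 0

/-- A complex function is a Möbius transformation if it is the restriction to `ℂ` of a map
`z ↦ (a z + b) / (c z + d)` of the Riemann sphere `OnePoint ℂ`, where `a d - b c ≠ 0`;
these maps are the action of `GL (Fin 2) ℂ` on `OnePoint ℂ`. -/
def IsMobius (f : ℂ → ℂ) : Prop :=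
  ∃ g : Matrix.GeneralLinearGroup (Fin 2) ℂ, ∀ z : ℂ, (f z : OnePoint ℂ) = g • (z : OnePoint ℂ)

/-! The map is the short-time flow in which `E` is moved by the Cauchy transform of its own moving
image: the velocity at time `t` is `v(z) = ∫ dζ / (z - ζ)` over `A = F_t(E)`. It is holomorphic off
`A`, so `F_t` stays holomorphic off `E`. Three estimates drive the argument.

Regularity: `v` is bounded and log-Lipschitz (`norm_velocity_sub_le`). Hence each short step changes
`logWeight` of a distance by a factor near `1`; these factors multiply along the flow and give
two-sided Hölder bounds with an exponent close to `1` for small time.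

Area: `∂̄v` is bounded with compact support in a fixed disc, and `∂v` has the same `L²` norm because
the Jacobian of `v` integrates to zero (`integral_norm_sq_d_velocity_le`). The area of the image of
`E` therefore decreases at a bounded rate and remains positive for a short time.

Infinity: `z v(z)` is close to the area of `A` far out, so positive area forces `Re (z (F(z) - z)) ≥
a > 0` for all large `z`. No Möbius map with finite values satisfies this (`not_isMobius_of_le_re`).

To avoid solving a singular flow equation, the kernel is smoothed at scale `δ` and time is
discretized by Euler steps whose size may depend on `δ`, while the accumulated bounds do not
(`exists_isApproxConformal`). A limit as `δ → 0` inherits the two-sided Hölder bounds and is a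
homeomorphism, holomorphic off `E`. The Hölder exponent `3/2 < 2` excludes critical points. -/

open MeasureTheory Filter Topology Metric Set
open scoped ContDiff ComplexConjugate

/-! ### Regularized Cauchy kernels with bounds uniform in the scale -/

/-- A smooth function `k` on the plane that agrees with the Cauchy kernel `z ↦ z⁻¹` for `‖z‖ ≥ δ`
and satisfies the size and difference estimates of the Cauchy kernel with a constant `C`. -/
structure IsRegularizedCauchyKernel (C δ : ℝ) (k : ℂ → ℂ) : Prop where
  contDiff : ContDiff ℝ ∞ k
  eq_inv : ∀ z, δ ≤ ‖z‖ → k z = z⁻¹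
  norm_le : ∀ z, ‖k z‖ ≤ ‖z‖⁻¹
  norm_sub_le : ∀ z w, z ≠ 0 → w ≠ 0 → ‖k z - k w‖ ≤ C * ‖z - w‖ * (‖z‖⁻¹ * ‖w‖⁻¹)
  norm_fderiv_le : ∀ z, ‖fderiv ℝ k z‖ ≤ C / δ ^ 2

/-- A smooth radial function that vanishes near the origin and is `1` off the unit disc. -/
noncomputable def radialCutoff (z : ℂ) : ℝ := Real.smoothTransition (2 * ‖z‖ ^ 2 - 1)

lemma radialCutoff_nonneg (z : ℂ) : 0 ≤ radialCutoff z := Real.smoothTransition.nonneg _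

lemma radialCutoff_le_one (z : ℂ) : radialCutoff z ≤ 1 := Real.smoothTransition.le_one _

lemma radialCutoff_eq_one {z : ℂ} (hz : 1 ≤ ‖z‖) : radialCutoff z = 1 :=
  Real.smoothTransition.one_of_one_le (by nlinarith)

lemma radialCutoff_eq_zero {z : ℂ} (hz : ‖z‖ ≤ 1 / 2) : radialCutoff z = 0 :=
  Real.smoothTransition.zero_of_nonpos (by nlinarith [norm_nonneg z])

lemma contDiff_radialCutoff : ContDiff ℝ ∞ radialCutoff := by
  have h : ContDiff ℝ ∞ (fun z : ℂ => 2 * ‖z‖ ^ 2 - 1) :=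
    (contDiff_const.mul (contDiff_norm_sq ℝ)).sub contDiff_const
  exact Real.smoothTransition.contDiff.comp h

lemma exists_lipschitzWith_radialCutoff : ∃ L, LipschitzWith L radialCutoff := by
  have h1 : ContDiff ℝ ∞ (fun z => radialCutoff z - 1) := contDiff_radialCutoff.sub contDiff_const
  have h2 : HasCompactSupport (fun z => radialCutoff z - 1) := by
    refine HasCompactSupport.intro (isCompact_closedBall (0 : ℂ) 1) fun z hz => ?_
    have : 1 < ‖z‖ := by simpa using hz
    simp [radialCutoff_eq_one this.le]
  obtain ⟨L, hL⟩ := h1.lipschitzWith_of_hasCompactSupport h2 (by simp)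
  refine ⟨L, LipschitzWith.of_dist_le_mul fun z w => ?_⟩
  have := hL.dist_le_mul z w
  simpa [Real.dist_eq] using this

/-- The factor `‖z‖` is harmless: for `‖z‖ ≤ 2` it is absorbed by the Lipschitz constant, and for
larger `z` the difference vanishes unless `w` lies in the unit disc, when `‖z‖ ≤ 2 ‖z - w‖`. -/
lemma exists_norm_mul_radialCutoff_sub_le :
    ∃ L : ℝ, 0 ≤ L ∧ ∀ z w : ℂ, ‖z‖ * |radialCutoff z - radialCutoff w| ≤ L * ‖z - w‖ := by
  obtain ⟨L, hL⟩ := exists_lipschitzWith_radialCutoff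
  have hLd : ∀ z w : ℂ, |radialCutoff z - radialCutoff w| ≤ L * ‖z - w‖ := fun z w => by
    simpa [Real.dist_eq, dist_eq_norm] using hL.dist_le_mul z w
  refine ⟨2 * L + 2, by positivity, fun z w => ?_⟩
  have hzw := norm_nonneg (z - w)
  have hL0 : (0 : ℝ) ≤ L := L.2
  rcases le_total ‖z‖ 2 with hz | hz
  · nlinarith [hLd z w, abs_nonneg (radialCutoff z - radialCutoff w), norm_nonneg z]
  · rw [radialCutoff_eq_one (by linarith)]
    rcases le_total 1 ‖w‖ with hw | hw
    · rw [radialCutoff_eq_one hw]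
      simp
      positivity
    · have h1 : ‖z‖ ≤ 2 * ‖z - w‖ := by linarith [norm_sub_norm_le z w]
      have h2 : |1 - radialCutoff w| ≤ 1 := by
        rw [abs_le]; constructor <;> linarith [radialCutoff_nonneg w, radialCutoff_le_one w]
      nlinarith [norm_nonneg z, mul_nonneg hL0 hzw]

/-- The Cauchy kernel, smoothly cut off near the origin at scale `1`. -/
noncomputable def truncatedInv (z : ℂ) : ℂ := radialCutoff z * z⁻¹

lemma contDiff_truncatedInv : ContDiff ℝ ∞ truncatedInv := by
  rw [contDiff_iff_contDiffAt]
  intro z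
  rcases eq_or_ne z 0 with rfl | hz
  · have : truncatedInv =ᶠ[𝓝 0] fun _ => 0 := by
      filter_upwards [ball_mem_nhds (0 : ℂ) (by norm_num : (0 : ℝ) < 1 / 2)] with w hw
      have : ‖w‖ < 1 / 2 := by simpa using hw
      simp [truncatedInv, radialCutoff_eq_zero this.le]
    exact contDiffAt_const.congr_of_eventuallyEq this
  · have h1 : ContDiffAt ℝ ∞ (fun w => ((radialCutoff w : ℝ) : ℂ)) z :=
      (Complex.ofRealCLM.contDiff.comp contDiff_radialCutoff).contDiffAt
    exact h1.mul (contDiffAt_inv ℝ hz)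

lemma truncatedInv_eq_inv {z : ℂ} (hz : 1 ≤ ‖z‖) : truncatedInv z = z⁻¹ := by
  simp [truncatedInv, radialCutoff_eq_one hz]

lemma norm_truncatedInv_le (z : ℂ) : ‖truncatedInv z‖ ≤ ‖z‖⁻¹ := by
  rw [truncatedInv, norm_mul, norm_inv, Complex.norm_real, Real.norm_eq_abs,
    abs_of_nonneg (radialCutoff_nonneg z)]
  exact mul_le_of_le_one_left (by positivity) (radialCutoff_le_one z)

lemma exists_norm_truncatedInv_sub_le : ∃ C : ℝ, 0 ≤ C ∧ ∀ z w : ℂ, z ≠ 0 → w ≠ 0 →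
    ‖truncatedInv z - truncatedInv w‖ ≤ C * ‖z - w‖ * (‖z‖⁻¹ * ‖w‖⁻¹) := by
  obtain ⟨L, hL0, hL⟩ := exists_norm_mul_radialCutoff_sub_le
  refine ⟨1 + L, by positivity, fun z w hz hw => ?_⟩
  have key : truncatedInv z - truncatedInv w =
      ((radialCutoff z : ℂ) * (w - z) + z * ((radialCutoff z - radialCutoff w : ℝ) : ℂ)) *
        (z⁻¹ * w⁻¹) := by
    rw [truncatedInv, truncatedInv]
    push_cast
    field_simp
    ring
  rw [key, norm_mul, norm_mul, norm_inv, norm_inv]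
  gcongr
  refine (norm_add_le _ _).trans ?_
  rw [norm_mul, norm_mul, Complex.norm_real, Complex.norm_real, Real.norm_eq_abs, Real.norm_eq_abs,
    abs_of_nonneg (radialCutoff_nonneg z), norm_sub_rev w z]
  nlinarith [hL z w, radialCutoff_le_one z, norm_nonneg (z - w)]

lemma fderiv_real_inv {z : ℂ} (hz : z ≠ 0) (e : ℂ) :
    fderiv ℝ (fun w : ℂ => w⁻¹) z e = -e * (z ^ 2)⁻¹ := by
  have h := (hasDerivAt_inv hz).hasFDerivAt.restrictScalars ℝ
  rw [h.fderiv]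
  simp

/-- A continuous function on the plane bounded by a multiple of `‖z‖ ^ (-p)` off the unit disc is
bounded by a multiple of `(1 + ‖z‖) ^ (-p)`. -/
lemma exists_norm_le_inv_one_add_norm_pow {F : Type*} [NormedAddCommGroup F] {g : ℂ → F}
    (hg : Continuous g) {c : ℝ} {p : ℕ} (hc : ∀ z, 1 < ‖z‖ → ‖g z‖ ≤ c * (‖z‖ ^ p)⁻¹) :
    ∃ C : ℝ, 0 ≤ C ∧ ∀ z, ‖g z‖ ≤ C * ((1 + ‖z‖) ^ p)⁻¹ := by
  obtain ⟨B, hB⟩ := (isCompact_closedBall (0 : ℂ) 1).exists_bound_of_continuousOn hg.continuousOn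
  refine ⟨2 ^ p * max |c| |B|, by positivity, fun z => ?_⟩
  rw [← div_eq_mul_inv, le_div_iff₀ (by positivity)]
  rcases le_or_gt ‖z‖ 1 with hz | hz
  · calc ‖g z‖ * (1 + ‖z‖) ^ p ≤ max |c| |B| * 2 ^ p := by
          gcongr
          · exact (hB z (by simpa using hz)).trans ((le_abs_self _).trans (le_max_right _ _))
          · linarith
      _ = _ := mul_comm _ _
  · have h0 : 0 < ‖z‖ ^ p := by positivity
    calc ‖g z‖ * (1 + ‖z‖) ^ p ≤ (max |c| |B| * (‖z‖ ^ p)⁻¹) * (2 * ‖z‖) ^ p := by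
          gcongr
          · refine (hc z hz).trans ?_
            gcongr
            exact (le_abs_self _).trans (le_max_left _ _)
          · linarith
      _ = _ := by rw [mul_pow]; field_simp

section ModelKernel

variable {k : ℂ → ℂ}

lemma fderiv_eq_of_eq_inv (hk : ∀ z, 1 < ‖z‖ → k z = z⁻¹) {z : ℂ} (hz : 1 < ‖z‖) (e : ℂ) :
    fderiv ℝ k z e = -e * (z ^ 2)⁻¹ := by
  have h : k =ᶠ[𝓝 z] fun w => w⁻¹ := by
    filter_upwards [(isOpen_lt continuous_const continuous_norm).mem_nhds hz] with w hw
    exact hk w hw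
  rw [h.fderiv_eq, fderiv_real_inv (by rintro rfl; simp at hz; linarith)]

lemma fderiv_fderiv_eq_of_eq_inv (hk : ∀ z, 1 < ‖z‖ → k z = z⁻¹) {z : ℂ} (hz : 1 < ‖z‖)
    (e e' : ℂ) : fderiv ℝ (fun w => fderiv ℝ k w e) z e' = 2 * e * e' * (z ^ 3)⁻¹ := by
  have hz0 : z ≠ 0 := by rintro rfl; simp at hz; linarith
  have h : (fun w => fderiv ℝ k w e) =ᶠ[𝓝 z] fun w => -e * (w ^ 2)⁻¹ := by
    filter_upwards [(isOpen_lt continuous_const continuous_norm).mem_nhds hz] with w hw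
    exact fderiv_eq_of_eq_inv hk hw e
  have h2 : HasDerivAt (fun w : ℂ => -e * (w ^ 2)⁻¹) (2 * e * (z ^ 3)⁻¹) z := by
    refine (((hasDerivAt_pow 2 z).fun_inv (pow_ne_zero 2 hz0)).const_mul (-e)).congr_deriv ?_
    push_cast
    field_simp
  rw [h.fderiv_eq, (h2.hasFDerivAt.restrictScalars ℝ).fderiv]
  simp
  ring

lemma exists_norm_fderiv_apply_le (hk : ContDiff ℝ ∞ k) (hk1 : ∀ z, 1 < ‖z‖ → k z = z⁻¹) (e : ℂ) :
    ∃ C : ℝ, 0 ≤ C ∧ ∀ z, ‖fderiv ℝ k z e‖ ≤ C * ((1 + ‖z‖) ^ 2)⁻¹ := by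
  refine exists_norm_le_inv_one_add_norm_pow (c := ‖e‖)
    ((hk.continuous_fderiv (by simp)).clm_apply continuous_const) fun z hz => ?_
  rw [fderiv_eq_of_eq_inv hk1 hz]
  simp

lemma contDiff_fderiv_apply_const (hk : ContDiff ℝ ∞ k) (e : ℂ) :
    ContDiff ℝ ∞ fun z => fderiv ℝ k z e :=
  (hk.fderiv_right (by simp)).clm_apply contDiff_const

lemma exists_norm_fderiv_fderiv_apply_le (hk : ContDiff ℝ ∞ k) (hk1 : ∀ z, 1 < ‖z‖ → k z = z⁻¹)
    (e e' : ℂ) : ∃ C : ℝ, 0 ≤ C ∧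
      ∀ z, ‖fderiv ℝ (fun w => fderiv ℝ k w e) z e'‖ ≤ C * ((1 + ‖z‖) ^ 2)⁻¹ := by
  refine exists_norm_le_inv_one_add_norm_pow (c := 2 * ‖e‖ * ‖e'‖)
    (((contDiff_fderiv_apply_const hk e).continuous_fderiv (by simp)).clm_apply continuous_const)
    fun z hz => ?_
  rw [fderiv_fderiv_eq_of_eq_inv hk1 hz]
  simp only [norm_mul, norm_inv, norm_pow, RCLike.norm_ofNat]
  gcongr
  · exact hz.le
  · norm_num

lemma exists_norm_fderiv_le (hk : ContDiff ℝ ∞ k) (hk1 : ∀ z, 1 < ‖z‖ → k z = z⁻¹) :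
    ∃ C : ℝ, 0 ≤ C ∧ ∀ z, ‖fderiv ℝ k z‖ ≤ C := by
  obtain ⟨C, hC0, hC⟩ := exists_norm_le_inv_one_add_norm_pow (c := 1) (p := 0)
    (hk.continuous_fderiv (by simp)) fun z hz => by
      refine ContinuousLinearMap.opNorm_le_bound _ (by simp) fun e => ?_
      rw [fderiv_eq_of_eq_inv hk1 hz]
      simp only [norm_mul, norm_neg, norm_inv, norm_pow, pow_zero, inv_one, mul_one, one_mul]
      refine mul_le_of_le_one_right (norm_nonneg e) (inv_le_one_of_one_le₀ ?_)
      nlinarith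
  exact ⟨C, hC0, by simpa using hC⟩

end ModelKernel

/-- The kernel at scale `δ` is `δ⁻¹ k(z / δ)`. Homogeneity of `z⁻¹` makes the size and difference
estimates scale invariant, while the derivative picks up exactly `δ⁻²`, so one `C` serves every `δ`.
-/
lemma exists_isRegularizedCauchyKernel : ∃ C : ℝ, 0 ≤ C ∧ ∀ δ : ℝ, 0 < δ →
    ∃ k : ℂ → ℂ, IsRegularizedCauchyKernel C δ k := by
  obtain ⟨C₁, hC₁, h1⟩ := exists_norm_truncatedInv_sub_le
  obtain ⟨C₂, hC₂, h2⟩ := exists_norm_fderiv_le contDiff_truncatedInv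
    fun z hz => truncatedInv_eq_inv hz.le
  refine ⟨max C₁ C₂, le_max_of_le_left hC₁, fun δ hδ =>
    ⟨fun z => (δ : ℂ)⁻¹ * truncatedInv ((δ⁻¹ : ℝ) • z), ?_⟩⟩
  have hδ' : (δ : ℂ) ≠ 0 := by exact_mod_cast hδ.ne'
  have hn : ∀ z : ℂ, ‖(δ⁻¹ : ℝ) • z‖ = δ⁻¹ * ‖z‖ := fun z => by
    rw [norm_smul, Real.norm_of_nonneg (by positivity)]
  have hnδ : ‖(δ : ℂ)⁻¹‖ = δ⁻¹ := by simp [abs_of_pos hδ]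
  refine ⟨?_, fun z hz => ?_, fun z => ?_, fun z w hz hw => ?_, fun z => ?_⟩
  · exact contDiff_const.mul (contDiff_truncatedInv.comp (contDiff_const_smul _))
  · rw [truncatedInv_eq_inv]
    · rw [Complex.real_smul]
      push_cast
      rw [mul_inv, inv_inv, ← mul_assoc, inv_mul_cancel₀ hδ', one_mul]
    · rw [hn, ← div_eq_inv_mul, le_div_iff₀ hδ]
      linarith
  · rw [norm_mul, hnδ]
    calc δ⁻¹ * ‖truncatedInv ((δ⁻¹ : ℝ) • z)‖ ≤ δ⁻¹ * ‖(δ⁻¹ : ℝ) • z‖⁻¹ := by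
          gcongr; exact norm_truncatedInv_le _
      _ = ‖z‖⁻¹ := by
          rw [hn, mul_inv, inv_inv, ← mul_assoc, inv_mul_cancel₀ hδ.ne', one_mul]
  · rw [← mul_sub, norm_mul, hnδ]
    have := h1 ((δ⁻¹ : ℝ) • z) ((δ⁻¹ : ℝ) • w) (smul_ne_zero (by positivity) hz)
      (smul_ne_zero (by positivity) hw)
    rw [← smul_sub, hn, hn, hn] at this
    calc _ ≤ δ⁻¹ * (C₁ * (δ⁻¹ * ‖z - w‖) * ((δ⁻¹ * ‖z‖)⁻¹ * (δ⁻¹ * ‖w‖)⁻¹)) := by gcongr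
      _ = C₁ * ‖z - w‖ * (‖z‖⁻¹ * ‖w‖⁻¹) := by
          rw [mul_inv, mul_inv]
          field_simp
      _ ≤ _ := by gcongr; exact le_max_left _ _
  · have hd : HasFDerivAt (fun z => (δ : ℂ)⁻¹ * truncatedInv ((δ⁻¹ : ℝ) • z))
        ((δ : ℂ)⁻¹ • ((fderiv ℝ truncatedInv ((δ⁻¹ : ℝ) • z)).comp
          ((δ⁻¹ : ℝ) • ContinuousLinearMap.id ℝ ℂ))) z := by
      have hi : HasFDerivAt (fun z : ℂ => (δ⁻¹ : ℝ) • z)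
          ((δ⁻¹ : ℝ) • ContinuousLinearMap.id ℝ ℂ) z := (hasFDerivAt_id z).const_smul (δ⁻¹ : ℝ)
      have ht : HasFDerivAt truncatedInv (fderiv ℝ truncatedInv ((δ⁻¹ : ℝ) • z)) ((δ⁻¹ : ℝ) • z) :=
        (contDiff_truncatedInv.differentiable (by simp) _).hasFDerivAt
      exact (ht.comp z hi).const_mul _
    rw [hd.fderiv, norm_smul, hnδ, ContinuousLinearMap.comp_smul, norm_smul,
      Real.norm_of_nonneg (by positivity : (0 : ℝ) ≤ δ⁻¹), ContinuousLinearMap.comp_id]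
    calc δ⁻¹ * (δ⁻¹ * ‖fderiv ℝ truncatedInv ((δ⁻¹ : ℝ) • z)‖) ≤ δ⁻¹ * (δ⁻¹ * max C₁ C₂) := by
          gcongr; exact (h2 _).trans (le_max_right _ _)
      _ = _ := by field_simp

/-! ### The logarithmic weight and integrals of powers of the distance -/

/-- The function `1 + log⁺ (1 / r)`, which controls the modulus of continuity of Cauchy transforms
of bounded functions. -/
noncomputable def logWeight (r : ℝ) : ℝ := 1 + max 0 (-Real.log r)

lemma one_le_logWeight (r : ℝ) : 1 ≤ logWeight r := by simp [logWeight]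

lemma logWeight_pos (r : ℝ) : 0 < logWeight r := zero_lt_one.trans_le (one_le_logWeight r)

lemma logWeight_anti {r s : ℝ} (hr : 0 < r) (hrs : r ≤ s) : logWeight s ≤ logWeight r := by
  unfold logWeight
  gcongr

lemma integrableOn_ball_norm_rpow {ε : ℝ} (hε : 0 < ε) :
    IntegrableOn (fun u : ℂ => ‖u‖ ^ (ε - 2)) (ball 0 1) := by
  rw [integrableOn_fun_norm_addHaar volume (f := fun y : ℝ => y ^ (ε - 2))]
  have h : IntegrableOn (fun y : ℝ => y ^ (ε - 1)) (Ioo 0 1) :=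
    (intervalIntegral.integrableOn_Ioo_rpow_iff zero_lt_one).2 (by linarith)
  refine h.congr_fun (fun y hy => ?_) measurableSet_Ioo
  have hy0 : 0 < y := hy.1
  simp only [Complex.finrank_real_complex, smul_eq_mul]
  rw [show ε - 1 = 1 + (ε - 2) by ring, Real.rpow_add hy0]
  simp

lemma setIntegral_norm_rpow {ε : ℝ} (hε : 0 < ε) :
    ∫ u : ℂ in ball 0 1, ‖u‖ ^ (ε - 2) = 2 * Real.pi / ε := by
  have h1 : ∫ u : ℂ in ball 0 1, ‖u‖ ^ (ε - 2) =
      ∫ u : ℂ, (Iio (1 : ℝ)).indicator (fun y => y ^ (ε - 2)) ‖u‖ := by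
    rw [← integral_indicator measurableSet_ball]
    congr 1 with u
    simp [indicator]
  rw [h1, integral_fun_norm_addHaar volume ((Iio (1 : ℝ)).indicator (fun y => y ^ (ε - 2)))]
  have h2 : ∫ y in Ioi (0 : ℝ), y ^ (Module.finrank ℝ ℂ - 1) •
      (Iio (1 : ℝ)).indicator (fun y => y ^ (ε - 2)) y = ∫ y in (0 : ℝ)..1, y ^ (ε - 1) := by
    rw [intervalIntegral.integral_of_le zero_le_one, integral_Ioc_eq_integral_Ioo,
      ← Ioi_inter_Iio, ← setIntegral_indicator measurableSet_Iio]
    refine setIntegral_congr_fun measurableSet_Ioi fun y (hy : 0 < y) => ?_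
    by_cases h : y < 1
    · simp only [Complex.finrank_real_complex, smul_eq_mul, mem_Iio, h, indicator_of_mem]
      rw [show ε - 1 = 1 + (ε - 2) by ring, Real.rpow_add hy]
      simp
    · simp [h]
  rw [h2, integral_rpow (Or.inl (by linarith))]
  simp [Measure.real, Complex.volume_ball, hε.ne']
  ring

lemma integrable_indicator_norm_rpow {ε : ℝ} (hε : 0 < ε) (z : ℂ) :
    Integrable fun ζ : ℂ => (ball (0 : ℂ) 1).indicator (fun u => ‖u‖ ^ (ε - 2)) (z - ζ) :=
  ((integrableOn_ball_norm_rpow hε).integrable_indicator measurableSet_ball).comp_sub_left z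

lemma norm_rpow_le_one_add_indicator {ε : ℝ} (hε : ε ≤ 1) (u : ℂ) :
    ‖u‖ ^ (ε - 2) ≤ 1 + (ball (0 : ℂ) 1).indicator (fun u => ‖u‖ ^ (ε - 2)) u := by
  by_cases h : ‖u‖ < 1
  · simp [h]
  · have : ‖u‖ ^ (ε - 2) ≤ 1 := Real.rpow_le_one_of_one_le_of_nonpos (not_lt.1 h) (by linarith)
    simpa [h] using this

lemma integrableOn_norm_sub_rpow {ε : ℝ} (hε : 0 < ε) (hε1 : ε ≤ 1) {A : Set ℂ} (hA : IsCompact A)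
    (z : ℂ) : IntegrableOn (fun ζ : ℂ => ‖z - ζ‖ ^ (ε - 2)) A := by
  refine Integrable.mono' (g := fun ζ => 1 +
    (ball (0 : ℂ) 1).indicator (fun u => ‖u‖ ^ (ε - 2)) (z - ζ)) ?_ ?_ (ae_of_all _ fun ζ => ?_)
  · exact Integrable.add (integrableOn_const hA.measure_lt_top.ne)
      (integrable_indicator_norm_rpow hε z).integrableOn
  · exact ((measurable_const.sub measurable_id).norm.pow_const _).aestronglyMeasurable
  · rw [Real.norm_of_nonneg (by positivity)]
    exact norm_rpow_le_one_add_indicator hε1 _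

lemma setIntegral_norm_sub_rpow_le {ε : ℝ} (hε : 0 < ε) (hε1 : ε ≤ 1) {A : Set ℂ}
    (hA : IsCompact A) (z : ℂ) :
    ∫ ζ in A, ‖z - ζ‖ ^ (ε - 2) ≤ volume.real A + 2 * Real.pi / ε := by
  have hi := integrable_indicator_norm_rpow hε z
  calc ∫ ζ in A, ‖z - ζ‖ ^ (ε - 2)
      ≤ ∫ ζ in A, (1 + (ball (0 : ℂ) 1).indicator (fun u => ‖u‖ ^ (ε - 2)) (z - ζ)) :=
        integral_mono (integrableOn_norm_sub_rpow hε hε1 hA z)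
          (Integrable.add (integrableOn_const hA.measure_lt_top.ne) hi.integrableOn)
          fun ζ => norm_rpow_le_one_add_indicator hε1 _
    _ = volume.real A + ∫ ζ in A, (ball (0 : ℂ) 1).indicator (fun u => ‖u‖ ^ (ε - 2)) (z - ζ) := by
        rw [integral_add (f := fun _ => (1 : ℝ)) (integrableOn_const hA.measure_lt_top.ne)
          hi.integrableOn]
        simp
    _ ≤ volume.real A + ∫ ζ, (ball (0 : ℂ) 1).indicator (fun u => ‖u‖ ^ (ε - 2)) (z - ζ) := by
        refine add_le_add_right ?_ _
        exact setIntegral_le_integral hi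
          (ae_of_all _ fun ζ => indicator_nonneg (fun _ _ => by positivity) _)
    _ = volume.real A + 2 * Real.pi / ε := by
        rw [integral_sub_left_eq_self
          (fun u => (ball (0 : ℂ) 1).indicator (fun u => ‖u‖ ^ (ε - 2)) u) volume z,
          integral_indicator measurableSet_ball, setIntegral_norm_rpow hε]

/-- The larger of `a` and `b` is at least `r / 2`, so a power `ε` of its inverse is traded for `(2 /
r) ^ ε`, and the remaining power is estimated by that of the smaller one. The exponent `ε - 2` is
then integrable in the plane. -/
lemma inv_mul_inv_le_rpow {a b r ε : ℝ} (ha : 0 < a) (hb : 0 < b) (hr : 0 < r) (hab : r ≤ a + b)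
    (hε : 0 < ε) (hε1 : ε ≤ 1) :
    a⁻¹ * b⁻¹ ≤ (2 / r) ^ ε * (a ^ (ε - 2) + b ^ (ε - 2)) := by
  wlog h : a ≤ b generalizing a b
  · rw [mul_comm a⁻¹, add_comm (a ^ _)]
    exact this hb ha (by linarith) (le_of_not_ge h)
  have h1 : b⁻¹ ≤ (2 / r) ^ ε * a ^ (ε - 1) := by
    have : b⁻¹ = b⁻¹ ^ ε * b ^ (ε - 1) := by
      rw [Real.inv_rpow hb.le, ← Real.rpow_neg hb.le, ← Real.rpow_add hb]
      rw [show -ε + (ε - 1) = -1 by ring, Real.rpow_neg_one]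
    rw [this]
    gcongr ?_ * ?_
    · refine Real.rpow_le_rpow (by positivity) ?_ hε.le
      rw [inv_le_comm₀ hb (by positivity), inv_div]
      linarith
    · exact Real.rpow_le_rpow_of_nonpos ha h (by linarith)
  calc a⁻¹ * b⁻¹ ≤ a⁻¹ * ((2 / r) ^ ε * a ^ (ε - 1)) := by gcongr
    _ = (2 / r) ^ ε * a ^ (ε - 2) := by
        rw [show ε - 2 = -1 + (ε - 1) by ring, Real.rpow_add ha, Real.rpow_neg_one]; ring
    _ ≤ _ := by
        gcongr
        have := Real.rpow_nonneg hb.le (ε - 2)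
        linarith

lemma two_div_rpow_inv_logWeight_le {r : ℝ} (hr : 0 < r) :
    (2 / r) ^ (logWeight r)⁻¹ ≤ Real.exp 1 := by
  have hY := logWeight_pos r
  rw [Real.rpow_def_of_pos (by positivity), Real.exp_le_exp, ← div_eq_mul_inv, div_le_one hY,
    Real.log_div two_ne_zero hr.ne']
  have h1 : -Real.log r ≤ max 0 (-Real.log r) := le_max_right _ _
  have h2 := Real.log_two_lt_d9
  unfold logWeight
  linarith

/-! ### The velocity field: size, modulus of continuity, holomorphy, far field -/

/-- The regularized Cauchy transform of the area measure on `A`. -/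
noncomputable def velocity (k : ℂ → ℂ) (A : Set ℂ) (z : ℂ) : ℂ := ∫ ζ in A, k (z - ζ)

lemma integrableOn_comp_sub_left {F : Type*} [NormedAddCommGroup F] {g : ℂ → F}
    (hg : Continuous g) {A : Set ℂ} (hA : IsCompact A) (z : ℂ) :
    IntegrableOn (fun ζ => g (z - ζ)) A :=
  (hg.comp (continuous_const.sub continuous_id)).continuousOn.integrableOn_compact hA

lemma hasFDerivAt_setIntegral_comp_sub {F : Type*} [NormedAddCommGroup F] [NormedSpace ℝ F]
    {g : ℂ → F} (hg : ContDiff ℝ ∞ g) {C : ℝ} (hC : ∀ z, ‖fderiv ℝ g z‖ ≤ C) {A : Set ℂ}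
    (hA : IsCompact A) (z : ℂ) :
    HasFDerivAt (fun z => ∫ ζ in A, g (z - ζ)) (∫ ζ in A, fderiv ℝ g (z - ζ)) z := by
  refine hasFDerivAt_integral_of_dominated_of_fderiv_le (F := fun z ζ => g (z - ζ))
    (F' := fun z ζ => fderiv ℝ g (z - ζ)) (bound := fun _ => C) univ_mem
    (Eventually.of_forall fun w => (integrableOn_comp_sub_left hg.continuous hA w).1)
    (integrableOn_comp_sub_left hg.continuous hA z)
    (integrableOn_comp_sub_left (hg.continuous_fderiv (by simp)) hA z).1
    (ae_of_all _ fun ζ w _ => hC _) (integrableOn_const hA.measure_lt_top.ne)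
    (ae_of_all _ fun ζ w _ => ?_)
  have h := (hg.differentiable (by simp) (w - ζ)).hasFDerivAt
  have h2 : HasFDerivAt (fun w : ℂ => w - ζ) (ContinuousLinearMap.id ℝ ℂ) w :=
    (hasFDerivAt_id w).sub_const ζ
  exact h.comp w h2

namespace IsRegularizedCauchyKernel

variable {C δ : ℝ} {k : ℂ → ℂ} {A : Set ℂ}

lemma norm_velocity_le (hk : IsRegularizedCauchyKernel C δ k) (hA : IsCompact A) (z : ℂ) :
    ‖velocity k A z‖ ≤ volume.real A + 2 * Real.pi := by
  refine (norm_integral_le_of_norm_le (integrableOn_norm_sub_rpow one_pos le_rfl hA z)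
    (ae_of_all _ fun ζ => ?_)).trans
    ((setIntegral_norm_sub_rpow_le one_pos le_rfl hA z).trans (by simp))
  rw [show (1 : ℝ) - 2 = -1 by norm_num, Real.rpow_neg_one]
  exact hk.norm_le _

lemma norm_velocity_sub_le (hk : IsRegularizedCauchyKernel C δ k) (hC : 0 ≤ C) (hA : IsCompact A)
    {z w : ℂ} (hzw : z ≠ w) :
    ‖velocity k A z - velocity k A w‖ ≤
      2 * Real.exp 1 * C * (volume.real A + 2 * Real.pi) * (‖z - w‖ * logWeight ‖z - w‖) := by
  set r := ‖z - w‖ with hr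
  have hr0 : 0 < r := norm_pos_iff.2 (sub_ne_zero.2 hzw)
  have hY := logWeight_pos r
  have hY1 := one_le_logWeight r
  -- This exponent balances the two costs: `(2 / r) ^ ε` stays below `e`, while the integrals, of
  -- order `1 / ε`, contribute exactly one factor `logWeight r`.
  set ε := (logWeight r)⁻¹ with hεdef
  have hε : 0 < ε := by positivity
  have hε1 : ε ≤ 1 := inv_le_one_of_one_le₀ hY1
  have hint := fun z => integrableOn_norm_sub_rpow hε hε1 hA z
  have hkc := hk.contDiff.continuous
  rw [velocity, velocity, ← integral_sub (integrableOn_comp_sub_left hkc hA z)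
    (integrableOn_comp_sub_left hkc hA w)]
  have hne : ∀ u : ℂ, ∀ᵐ ζ ∂(volume.restrict A), ζ ≠ u := fun u =>
    ae_restrict_of_ae (by simp [ae_iff])
  have hpt : ∀ᵐ ζ ∂(volume.restrict A), ‖k (z - ζ) - k (w - ζ)‖ ≤
      C * r * (Real.exp 1 * (‖z - ζ‖ ^ (ε - 2) + ‖w - ζ‖ ^ (ε - 2))) := by
    filter_upwards [hne z, hne w] with ζ hz hw
    have hz' : z - ζ ≠ 0 := sub_ne_zero.2 hz.symm
    have hw' : w - ζ ≠ 0 := sub_ne_zero.2 hw.symm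
    have h1 := hk.norm_sub_le _ _ hz' hw'
    rw [sub_sub_sub_cancel_right, ← hr] at h1
    refine h1.trans (mul_le_mul_of_nonneg_left ?_ (by positivity))
    refine (inv_mul_inv_le_rpow (norm_pos_iff.2 hz') (norm_pos_iff.2 hw') hr0 ?_ hε hε1).trans ?_
    · rw [hr, ← sub_sub_sub_cancel_right z w ζ]
      exact _root_.norm_sub_le _ _
    · gcongr
      exact two_div_rpow_inv_logWeight_le hr0
  have hadd : IntegrableOn (fun ζ => ‖z - ζ‖ ^ (ε - 2) + ‖w - ζ‖ ^ (ε - 2)) A :=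
    (hint z).add (hint w)
  refine (norm_integral_le_of_norm_le ((hadd.const_mul _).const_mul _) hpt).trans ?_
  simp only [integral_const_mul]
  rw [integral_add (hint z) (hint w)]
  have hb : ∀ z, ∫ ζ in A, ‖z - ζ‖ ^ (ε - 2) ≤
      (volume.real A + 2 * Real.pi) * logWeight r := fun z => by
    refine (setIntegral_norm_sub_rpow_le hε hε1 hA z).trans ?_
    rw [hεdef, div_inv_eq_mul, add_mul]
    gcongr
    exact le_mul_of_one_le_right (by positivity) hY1
  calc _ ≤ C * r * (Real.exp 1 * ((volume.real A + 2 * Real.pi) * logWeight r +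
        (volume.real A + 2 * Real.pi) * logWeight r)) := by
        gcongr
        · exact hb z
        · exact hb w
    _ = _ := by ring

lemma hasFDerivAt_velocity (hk : IsRegularizedCauchyKernel C δ k) (hA : IsCompact A) (z : ℂ) :
    HasFDerivAt (velocity k A) (∫ ζ in A, fderiv ℝ k (z - ζ)) z :=
  hasFDerivAt_setIntegral_comp_sub hk.contDiff hk.norm_fderiv_le hA z

lemma lipschitzWith_velocity (hk : IsRegularizedCauchyKernel C δ k) (hC : 0 ≤ C)
    (hA : IsCompact A) {V : ℝ} (hV : volume.real A ≤ V) :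
    LipschitzWith (Real.toNNReal (V * (C / δ ^ 2))) (velocity k A) := by
  refine lipschitzWith_of_nnnorm_fderiv_le
    (fun z => (hk.hasFDerivAt_velocity hA z).differentiableAt) fun z => ?_
  rw [(hk.hasFDerivAt_velocity hA z).fderiv, ← norm_toNNReal]
  refine Real.toNNReal_le_toNNReal ?_
  calc _ ≤ C / δ ^ 2 * volume.real A :=
        norm_setIntegral_le_of_norm_le_const hA.measure_lt_top fun ζ _ => hk.norm_fderiv_le _
    _ ≤ _ := by rw [mul_comm]; gcongr

lemma fderiv_apply_I (hk : IsRegularizedCauchyKernel C δ k) {z : ℂ} (hδ : 0 < δ) (hz : δ < ‖z‖) :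
    fderiv ℝ k z Complex.I = Complex.I • fderiv ℝ k z 1 := by
  have h : k =ᶠ[𝓝 z] fun w => w⁻¹ := by
    filter_upwards [(isOpen_lt continuous_const continuous_norm).mem_nhds hz] with w hw
    exact hk.eq_inv w (le_of_lt hw)
  have hz0 : z ≠ 0 := norm_pos_iff.1 (hδ.trans hz)
  rw [h.fderiv_eq, fderiv_real_inv hz0, fderiv_real_inv hz0]
  simp

lemma fderiv_velocity_apply (hk : IsRegularizedCauchyKernel C δ k) (hA : IsCompact A) (z e : ℂ) :
    fderiv ℝ (velocity k A) z e = ∫ ζ in A, fderiv ℝ k (z - ζ) e := by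
  rw [(hk.hasFDerivAt_velocity hA z).fderiv, ContinuousLinearMap.integral_apply]
  exact integrableOn_comp_sub_left (hk.contDiff.continuous_fderiv (by simp)) hA z

/-- At distance more than `δ` from `A` only values of the kernel equal to `z⁻¹` enter, and the
Cauchy–Riemann equation passes under the integral. -/
lemma differentiableAt_velocity (hk : IsRegularizedCauchyKernel C δ k) (hδ : 0 < δ)
    (hA : IsCompact A) {z : ℂ} (hz : ∀ ζ ∈ A, δ < ‖z - ζ‖) :
    DifferentiableAt ℂ (velocity k A) z := by
  rw [differentiableAt_complex_iff_differentiableAt_real]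
  refine ⟨(hk.hasFDerivAt_velocity hA z).differentiableAt, ?_⟩
  rw [hk.fderiv_velocity_apply hA, hk.fderiv_velocity_apply hA, ← integral_smul]
  exact setIntegral_congr_fun hA.measurableSet fun ζ hζ => hk.fderiv_apply_I hδ (hz ζ hζ)

/-- Far away from `A`, the velocity at `u` behaves like `volume A / u`. -/
lemma norm_mul_velocity_sub_le (hk : IsRegularizedCauchyKernel C δ k) (hδ : δ ≤ 1)
    (hA : IsCompact A) {R : ℝ} (hAR : A ⊆ closedBall 0 R) {z u : ℂ} (hzu : ‖u - z‖ ≤ 1)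
    (hz : R + 2 ≤ ‖z‖) :
    ‖z * velocity k A u - volume.real A‖ ≤ (1 + R) / (‖z‖ - 1 - R) * volume.real A := by
  have h1 : z * velocity k A u - volume.real A = ∫ ζ in A, (z * k (u - ζ) - 1) := by
    rw [integral_sub ((integrableOn_comp_sub_left hk.contDiff.continuous hA u).const_mul z)
      (integrableOn_const hA.measure_lt_top.ne), integral_const_mul]
    simp [velocity]
  rw [h1]
  refine norm_setIntegral_le_of_norm_le_const hA.measure_lt_top fun ζ hζ => ?_
  have hζR : ‖ζ‖ ≤ R := by simpa using hAR hζ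
  have h2 : ‖z‖ - 1 - R ≤ ‖u - ζ‖ := by
    have : ‖z‖ ≤ ‖u - ζ‖ + ‖u - z‖ + ‖ζ‖ := by
      calc ‖z‖ = ‖(u - ζ) - (u - z) + ζ‖ := by congr 1; ring
        _ ≤ ‖(u - ζ) - (u - z)‖ + ‖ζ‖ := norm_add_le _ _
        _ ≤ _ := by gcongr; exact _root_.norm_sub_le _ _
    linarith
  have h3 : (1 : ℝ) ≤ ‖z‖ - 1 - R := by linarith
  have h4 : u - ζ ≠ 0 := norm_pos_iff.1 (by linarith)
  rw [hk.eq_inv _ (by linarith)]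
  have h5 : z * (u - ζ)⁻¹ - 1 = (ζ - (u - z)) / (u - ζ) := by
    field_simp
    ring
  rw [h5, norm_div]
  have h6 := norm_nonneg ζ
  gcongr
  · linarith
  · linarith [_root_.norm_sub_le ζ (u - z)]

end IsRegularizedCauchyKernel

/-! ### The Jacobian of the velocity has integral zero -/

lemma det_eq_im_conj_mul (L : ℂ →L[ℝ] ℂ) : L.det = (conj (L 1) * L Complex.I).im := by
  rw [ContinuousLinearMap.det, ← LinearMap.det_toMatrix Complex.basisOneI, Matrix.det_fin_two]
  simp [LinearMap.toMatrix_apply, Complex.basisOneI]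
  ring

lemma integrable_of_norm_le_inv_one_add_norm_pow {F : Type*} [NormedAddCommGroup F] {g : ℂ → F}
    (hg : Continuous g) {C : ℝ} (hC : ∀ z, ‖g z‖ ≤ C * ((1 + ‖z‖) ^ 3)⁻¹) : Integrable g := by
  have h : Integrable fun z : ℂ => (1 + ‖z‖) ^ (-(3 : ℝ)) :=
    integrable_one_add_norm (by simp; norm_num)
  refine (h.const_mul C).mono' hg.aestronglyMeasurable (ae_of_all _ fun z => (hC z).trans_eq ?_)
  rw [Real.rpow_neg (by positivity)]
  norm_cast

/-- The real bilinear form `(a, b) ↦ Im (conj a * b)` on the complex plane. -/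
noncomputable def imConjMul : ℂ →L[ℝ] ℂ →L[ℝ] ℝ :=
  (ContinuousLinearMap.compL ℝ ℂ ℂ ℝ Complex.imCLM) ∘L (ContinuousLinearMap.mul ℝ ℂ) ∘L
    (Complex.conjCLE : ℂ →L[ℝ] ℂ)

lemma imConjMul_apply (a b : ℂ) : imConjMul a b = (conj a * b).im := rfl

lemma imConjMul_swap (a b : ℂ) : imConjMul a b = -imConjMul b a := by
  simp only [imConjMul_apply, Complex.mul_im, Complex.conj_re, Complex.conj_im]
  ring

lemma norm_imConjMul_le (a b : ℂ) : ‖imConjMul a b‖ ≤ ‖a‖ * ‖b‖ := by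
  rw [imConjMul_apply, Real.norm_eq_abs]
  exact (Complex.abs_im_le_norm _).trans_eq (by simp)

lemma integrable_imConjMul {f g : ℂ → ℂ} (hf : Continuous f) (hg : Continuous g) {a b : ℝ}
    (ha : ∀ z, ‖f z‖ ≤ a * ((1 + ‖z‖) ^ 2)⁻¹) (hb : ∀ z, ‖g z‖ ≤ b * ((1 + ‖z‖) ^ 1)⁻¹) :
    Integrable fun z => imConjMul (f z) (g z) := by
  refine integrable_of_norm_le_inv_one_add_norm_pow (C := a * b)
    ((imConjMul.continuous.comp hf).clm_apply hg) fun z => ?_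
  calc _ ≤ ‖f z‖ * ‖g z‖ := norm_imConjMul_le _ _
    _ ≤ (a * ((1 + ‖z‖) ^ 2)⁻¹) * (b * ((1 + ‖z‖) ^ 1)⁻¹) :=
        mul_le_mul (ha z) (hb z) (norm_nonneg _) ((norm_nonneg _).trans (ha z))
    _ = _ := by
        have : 1 + ‖z‖ ≠ 0 := by positivity
        field_simp

lemma norm_le_inv_one_add_norm_of_sq {g : ℂ → ℂ} {b : ℝ}
    (hb : ∀ z, ‖g z‖ ≤ b * ((1 + ‖z‖) ^ 2)⁻¹) (z : ℂ) : ‖g z‖ ≤ b * ((1 + ‖z‖) ^ 1)⁻¹ := by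
  have h1 : (1 : ℝ) ≤ 1 + ‖z‖ := by linarith [norm_nonneg z]
  have hb0 : 0 ≤ b := by simpa using (norm_nonneg _).trans (hb 0)
  refine (hb z).trans ?_
  gcongr
  norm_num

/-- The integral of the Jacobian determinant of a sufficiently decaying planar map vanishes. -/
lemma integral_imConjMul_eq_zero {v vx vy w : ℂ → ℂ} (hv : Continuous v) (hvx : Continuous vx)
    (hvy : Continuous vy) (hw : Continuous w) {a b c d : ℝ}
    (ha : ∀ z, ‖v z‖ ≤ a * ((1 + ‖z‖) ^ 1)⁻¹) (hb : ∀ z, ‖vx z‖ ≤ b * ((1 + ‖z‖) ^ 2)⁻¹)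
    (hc : ∀ z, ‖vy z‖ ≤ c * ((1 + ‖z‖) ^ 2)⁻¹) (hd : ∀ z, ‖w z‖ ≤ d * ((1 + ‖z‖) ^ 2)⁻¹)
    (hx : ∀ z, HasLineDerivAt ℝ v (vx z) z 1) (hy : ∀ z, HasLineDerivAt ℝ v (vy z) z Complex.I)
    (hxy : ∀ z, HasLineDerivAt ℝ vx (w z) z Complex.I)
    (hyx : ∀ z, HasLineDerivAt ℝ vy (w z) z 1) :
    ∫ z, imConjMul (vx z) (vy z) = 0 := by
  -- Both integrations by parts lead to `-∫ imConjMul w v`, because the mixed derivatives agree. So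
  -- the integral is symmetric in `vx`, `vy`; being also antisymmetric, it vanishes.
  have h1 := integral_bilinear_hasLineDerivAt_right_eq_neg_left_of_integrable (μ := volume)
    (B := imConjMul) (integrable_imConjMul hw hv hd ha)
    (integrable_imConjMul hvx hvy hb (norm_le_inv_one_add_norm_of_sq hc))
    (integrable_imConjMul hvx hv hb ha) (fun z _ => hxy z) (fun z _ => hy z)
  have h2 := integral_bilinear_hasLineDerivAt_right_eq_neg_left_of_integrable (μ := volume)
    (B := imConjMul) (integrable_imConjMul hw hv hd ha)
    (integrable_imConjMul hvy hvx hc (norm_le_inv_one_add_norm_of_sq hb))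
    (integrable_imConjMul hvy hv hc ha) (fun z _ => hyx z) (fun z _ => hx z)
  have h3 : ∫ z, imConjMul (vx z) (vy z) = -∫ z, imConjMul (vy z) (vx z) := by
    rw [← integral_neg]
    exact integral_congr_ae (ae_of_all _ fun z => imConjMul_swap _ _)
  linarith

lemma continuous_velocity {g : ℂ → ℂ} (hg : Continuous g) {C : ℝ} (hC : ∀ z, ‖g z‖ ≤ C)
    {A : Set ℂ} (hA : IsCompact A) : Continuous (velocity g A) :=
  continuous_of_dominated (bound := fun _ => C)
    (fun z => (integrableOn_comp_sub_left hg hA z).1) (fun z => ae_of_all _ fun ζ => hC _)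
    (integrableOn_const hA.measure_lt_top.ne)
    (ae_of_all _ fun ζ => hg.comp (continuous_id.sub continuous_const))

/-- Translation by a point of the disc of radius `R` costs a factor `1 + R` per power, since `1 +
‖z‖ ≤ (1 + R) (1 + ‖z - ζ‖)`. -/
lemma norm_velocity_le_inv_one_add_norm_pow {g : ℂ → ℂ} {C : ℝ} {p : ℕ} (hC0 : 0 ≤ C)
    (hC : ∀ z, ‖g z‖ ≤ C * ((1 + ‖z‖) ^ p)⁻¹) {A : Set ℂ} (hA : IsCompact A) {R : ℝ} (hR : 0 ≤ R)
    (hAR : A ⊆ closedBall 0 R) (z : ℂ) :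
    ‖velocity g A z‖ ≤ C * (1 + R) ^ p * volume.real A * ((1 + ‖z‖) ^ p)⁻¹ := by
  have h : ∀ ζ ∈ A, ‖g (z - ζ)‖ ≤ C * (1 + R) ^ p * ((1 + ‖z‖) ^ p)⁻¹ := fun ζ hζ => by
    refine (hC _).trans ?_
    rw [mul_assoc]
    refine mul_le_mul_of_nonneg_left ?_ hC0
    rw [← div_eq_mul_inv, ← div_pow, ← inv_pow]
    refine pow_le_pow_left₀ (by positivity) ?_ p
    rw [inv_eq_one_div, div_le_div_iff₀ (by positivity) (by positivity)]
    have h1 : ‖ζ‖ ≤ R := by simpa using hAR hζ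
    have h2 : ‖z‖ ≤ ‖z - ζ‖ + ‖ζ‖ := by simpa using norm_add_le (z - ζ) ζ
    nlinarith [norm_nonneg (z - ζ), mul_nonneg hR (norm_nonneg (z - ζ))]
  refine (norm_setIntegral_le_of_norm_le_const hA.measure_lt_top h).trans_eq ?_
  ring

lemma hasLineDerivAt_velocity {g : ℂ → ℂ} (hg : ContDiff ℝ ∞ g) {C : ℝ}
    (hC : ∀ z, ‖fderiv ℝ g z‖ ≤ C) {A : Set ℂ} (hA : IsCompact A) (z e : ℂ) :
    HasLineDerivAt ℝ (velocity g A) (velocity (fun w => fderiv ℝ g w e) A z) z e := by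
  have h := (hasFDerivAt_setIntegral_comp_sub hg hC hA z).hasLineDerivAt e
  rwa [ContinuousLinearMap.integral_apply
    (integrableOn_comp_sub_left (hg.continuous_fderiv (by simp)) hA z)] at h

lemma exists_norm_fderiv_fderiv_le {k : ℂ → ℂ} (hk : ContDiff ℝ ∞ k)
    (hk1 : ∀ z, 1 < ‖z‖ → k z = z⁻¹) (e : ℂ) :
    ∃ C : ℝ, ∀ z, ‖fderiv ℝ (fun w => fderiv ℝ k w e) z‖ ≤ C := by
  obtain ⟨C, -, hC⟩ := exists_norm_le_inv_one_add_norm_pow (c := 2 * ‖e‖) (p := 0)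
    ((contDiff_fderiv_apply_const hk e).continuous_fderiv (by simp)) fun z hz => by
      refine ContinuousLinearMap.opNorm_le_bound _ (by simp) fun e' => ?_
      rw [fderiv_fderiv_eq_of_eq_inv hk1 hz]
      simp only [norm_mul, norm_inv, norm_pow, pow_zero, inv_one, mul_one, RCLike.norm_ofNat]
      exact mul_le_of_le_one_right (by positivity) (inv_le_one_of_one_le₀ (one_le_pow₀ hz.le))
  exact ⟨C, by simpa using hC⟩

lemma fderiv_fderiv_apply_comm {k : ℂ → ℂ} (hk : ContDiff ℝ ∞ k) (z e e' : ℂ) :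
    fderiv ℝ (fun w => fderiv ℝ k w e) z e' = fderiv ℝ (fun w => fderiv ℝ k w e') z e := by
  have hd : DifferentiableAt ℝ (fderiv ℝ k) z :=
    (hk.fderiv_right (m := ∞) (by simp)).differentiable (by simp) z
  have h : ∀ e e' : ℂ, fderiv ℝ (fun w => fderiv ℝ k w e) z e' =
      fderiv ℝ (fderiv ℝ k) z e' e := fun e e' => by
    rw [fderiv_clm_apply hd (differentiableAt_const e)]
    simp
  rw [h, h]
  exact ((contDiff_infty.1 hk 2).contDiffAt.isSymmSndFDerivAt (by simp)) e' e

namespace IsRegularizedCauchyKernel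

variable {C δ : ℝ} {k : ℂ → ℂ} {A : Set ℂ}

lemma integral_jacobian_velocity (hk : IsRegularizedCauchyKernel C δ k) (hδ : δ ≤ 1)
    (hA : IsCompact A) {R : ℝ} (hR : 0 ≤ R) (hAR : A ⊆ closedBall 0 R) :
    Integrable (fun z => imConjMul (velocity (fun w => fderiv ℝ k w 1) A z)
        (velocity (fun w => fderiv ℝ k w Complex.I) A z)) ∧
      ∫ z, imConjMul (velocity (fun w => fderiv ℝ k w 1) A z)
        (velocity (fun w => fderiv ℝ k w Complex.I) A z) = 0 := by
  have hk1 : ∀ z, 1 < ‖z‖ → k z = z⁻¹ := fun z hz => hk.eq_inv z (hδ.trans hz.le)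
  have hkd := hk.contDiff
  obtain ⟨c₀, hc₀, h₀⟩ := exists_norm_le_inv_one_add_norm_pow (c := 1) (p := 1) hkd.continuous
    fun z hz => by simpa using hk.norm_le z
  obtain ⟨c₁, hc₁, h₁⟩ := exists_norm_fderiv_apply_le hkd hk1 1
  obtain ⟨c₂, hc₂, h₂⟩ := exists_norm_fderiv_apply_le hkd hk1 Complex.I
  obtain ⟨c₃, hc₃, h₃⟩ := exists_norm_fderiv_fderiv_apply_le hkd hk1 1 Complex.I
  obtain ⟨b₁, hb₁⟩ := exists_norm_fderiv_fderiv_le hkd hk1 1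
  obtain ⟨b₂, hb₂⟩ := exists_norm_fderiv_fderiv_le hkd hk1 Complex.I
  have hbd : ∀ {c : ℝ} {p : ℕ} {g : ℂ → ℂ}, 0 ≤ c → (∀ z, ‖g z‖ ≤ c * ((1 + ‖z‖) ^ p)⁻¹) →
      ∀ z, ‖g z‖ ≤ c := fun {c p g} hc h z => (h z).trans
    (mul_le_of_le_one_right hc (inv_le_one_of_one_le₀ (one_le_pow₀
      (by linarith [norm_nonneg z]))))
  have hkx := contDiff_fderiv_apply_const hkd 1
  have hky := contDiff_fderiv_apply_const hkd Complex.I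
  have hkxy : Continuous fun z => fderiv ℝ (fun w => fderiv ℝ k w 1) z Complex.I :=
    (hkx.continuous_fderiv (by simp)).clm_apply continuous_const
  have cx := continuous_velocity hkx.continuous (hbd hc₁ h₁) hA
  have cy := continuous_velocity hky.continuous (hbd hc₂ h₂) hA
  have dx := norm_velocity_le_inv_one_add_norm_pow hc₁ h₁ hA hR hAR
  have dy := norm_velocity_le_inv_one_add_norm_pow hc₂ h₂ hA hR hAR
  refine ⟨integrable_imConjMul cx cy dx (norm_le_inv_one_add_norm_of_sq dy),
    integral_imConjMul_eq_zero (continuous_velocity hkd.continuous (hbd hc₀ h₀) hA) cx cy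
      (continuous_velocity hkxy (hbd hc₃ h₃) hA)
      (norm_velocity_le_inv_one_add_norm_pow hc₀ h₀ hA hR hAR) dx dy
      (norm_velocity_le_inv_one_add_norm_pow hc₃ h₃ hA hR hAR)
      (fun z => hasLineDerivAt_velocity hkd hk.norm_fderiv_le hA z 1)
      (fun z => hasLineDerivAt_velocity hkd hk.norm_fderiv_le hA z Complex.I)
      (fun z => hasLineDerivAt_velocity hkx hb₁ hA z Complex.I) (fun z => ?_)⟩
  convert hasLineDerivAt_velocity hky hb₂ hA z 1 using 3 with w
  exact fderiv_fderiv_apply_comm hkd _ _ _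

end IsRegularizedCauchyKernel

/-! ### The `∂` and `∂̄` derivatives and the loss of area in one step -/

lemma four_mul_imConjMul (p q : ℂ) :
    4 * imConjMul p q = ‖p - Complex.I * q‖ ^ 2 - ‖p + Complex.I * q‖ ^ 2 := by
  rw [← Complex.normSq_eq_norm_sq, ← Complex.normSq_eq_norm_sq, Complex.normSq_apply,
    Complex.normSq_apply, imConjMul_apply]
  simp
  ring

lemma det_id_add_smul (L : ℂ →L[ℝ] ℂ) (τ : ℝ) :
    (ContinuousLinearMap.id ℝ ℂ + τ • L).det =
      1 + τ * (L 1 - Complex.I * L Complex.I).re + τ ^ 2 * imConjMul (L 1) (L Complex.I) := by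
  rw [det_eq_im_conj_mul, imConjMul_apply]
  simp
  ring

/-- Only the square of the `∂` part is controlled in the mean, so the linear term is absorbed by `1
+ n²`. The quadratic term is negative only through the `∂̄` part, which is bounded by `M`. -/
lemma le_det_id_add_smul (L : ℂ →L[ℝ] ℂ) {τ M : ℝ} (hτ : 0 ≤ τ) (hτ1 : τ ≤ 1)
    (hM : ‖L 1 + Complex.I * L Complex.I‖ ≤ M) :
    1 - τ * (1 + M ^ 2 + ‖L 1 - Complex.I * L Complex.I‖ ^ 2) ≤
      (ContinuousLinearMap.id ℝ ℂ + τ • L).det := by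
  rw [det_id_add_smul]
  have h1 := four_mul_imConjMul (L 1) (L Complex.I)
  have h2 := (abs_le.1 (Complex.abs_re_le_norm (L 1 - Complex.I * L Complex.I))).1
  have h3 : ‖L 1 + Complex.I * L Complex.I‖ ^ 2 ≤ M ^ 2 := by gcongr
  set n := ‖L 1 - Complex.I * L Complex.I‖
  have h4 : -M ^ 2 ≤ imConjMul (L 1) (L Complex.I) := by nlinarith [sq_nonneg n]
  have h5 : τ ^ 2 * (-M ^ 2) ≤ τ ^ 2 * imConjMul (L 1) (L Complex.I) := by gcongr
  have h6 : τ ^ 2 * M ^ 2 ≤ τ * M ^ 2 := by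
    gcongr
    nlinarith
  have h7 : -(1 + n ^ 2) ≤ (L 1 - Complex.I * L Complex.I).re := by nlinarith [sq_nonneg (n - 1)]
  nlinarith [mul_le_mul_of_nonneg_left h7 hτ]

namespace IsRegularizedCauchyKernel

variable {C δ : ℝ} {k : ℂ → ℂ} {A : Set ℂ}

lemma velocity_fderiv_apply (hk : IsRegularizedCauchyKernel C δ k) (hA : IsCompact A) (z e : ℂ) :
    velocity (fun w => fderiv ℝ k w e) A z = fderiv ℝ (velocity k A) z e :=
  (hk.fderiv_velocity_apply hA z e).symm

lemma continuous_fderiv_velocity_apply (hk : IsRegularizedCauchyKernel C δ k) (hA : IsCompact A)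
    (e : ℂ) : Continuous fun z => fderiv ℝ (velocity k A) z e := by
  simp_rw [← hk.velocity_fderiv_apply hA]
  refine continuous_velocity (C := C / δ ^ 2 * ‖e‖)
    (contDiff_fderiv_apply_const hk.contDiff e).continuous (fun z => ?_) hA
  exact (ContinuousLinearMap.le_opNorm _ _).trans (by gcongr; exact hk.norm_fderiv_le z)

lemma dbar_velocity_eq (hk : IsRegularizedCauchyKernel C δ k) (hA : IsCompact A) (z : ℂ) :
    fderiv ℝ (velocity k A) z 1 + Complex.I * fderiv ℝ (velocity k A) z Complex.I =
      ∫ ζ in A, (fderiv ℝ k (z - ζ) 1 + Complex.I * fderiv ℝ k (z - ζ) Complex.I) := by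
  have h : ∀ e : ℂ, IntegrableOn (fun ζ => fderiv ℝ k (z - ζ) e) A := fun e =>
    integrableOn_comp_sub_left (contDiff_fderiv_apply_const hk.contDiff e).continuous hA z
  rw [hk.fderiv_velocity_apply hA, hk.fderiv_velocity_apply hA,
    integral_add (h 1) ((h Complex.I).const_mul _), integral_const_mul]

lemma dbar_eq_zero (hk : IsRegularizedCauchyKernel C δ k) (hδ : 0 < δ) {z : ℂ} (hz : δ < ‖z‖) :
    fderiv ℝ k z 1 + Complex.I * fderiv ℝ k z Complex.I = 0 := by
  rw [hk.fderiv_apply_I hδ hz, smul_eq_mul, ← mul_assoc, Complex.I_mul_I]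
  ring

lemma norm_dbar_le (hk : IsRegularizedCauchyKernel C δ k) (z : ℂ) :
    ‖fderiv ℝ k z 1 + Complex.I * fderiv ℝ k z Complex.I‖ ≤ 2 * (C / δ ^ 2) := by
  have h : ∀ e : ℂ, ‖e‖ = 1 → ‖fderiv ℝ k z e‖ ≤ C / δ ^ 2 := fun e he =>
    ((fderiv ℝ k z).le_opNorm e).trans (by rw [he, mul_one]; exact hk.norm_fderiv_le z)
  refine (norm_add_le _ _).trans ?_
  rw [norm_mul, Complex.norm_I, one_mul]
  linarith [h 1 (by simp), h Complex.I (by simp)]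

/-- The `∂̄` derivative of the kernel is of order `δ⁻²` and vanishes off a disc of area `π δ²`; the
powers of `δ` cancel. -/
lemma norm_dbar_velocity_le (hk : IsRegularizedCauchyKernel C δ k) (hδ : 0 < δ) (hA : IsCompact A)
    (z : ℂ) : ‖fderiv ℝ (velocity k A) z 1 + Complex.I * fderiv ℝ (velocity k A) z Complex.I‖ ≤
      2 * Real.pi * C := by
  rw [hk.dbar_velocity_eq hA, setIntegral_eq_of_subset_of_forall_sdiff_eq_zero hA.measurableSet
    (inter_subset_left : A ∩ closedBall z δ ⊆ A) fun ζ hζ => hk.dbar_eq_zero hδ ?_]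
  · have hfin : volume (closedBall z δ) < ⊤ := measure_closedBall_lt_top
    refine (norm_setIntegral_le_of_norm_le_const
      ((measure_mono inter_subset_right).trans_lt hfin) fun ζ _ => hk.norm_dbar_le _).trans ?_
    have h0 : 0 ≤ C / δ ^ 2 := (norm_nonneg _).trans (hk.norm_fderiv_le 0)
    calc 2 * (C / δ ^ 2) * volume.real (A ∩ closedBall z δ)
        ≤ 2 * (C / δ ^ 2) * volume.real (closedBall z δ) := by
          gcongr
          · exact hfin.ne
          · exact inter_subset_right
      _ = 2 * Real.pi * C := by
          simp [Measure.real, Complex.volume_closedBall, hδ.le]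
          field_simp
  · have : ζ ∉ closedBall z δ := fun h => hζ.2 ⟨hζ.1, h⟩
    rw [mem_closedBall, not_le, dist_comm, dist_eq_norm] at this
    exact this

lemma dbar_velocity_eq_zero (hk : IsRegularizedCauchyKernel C δ k) (hδ : 0 < δ) (hδ1 : δ ≤ 1)
    (hA : IsCompact A) {R : ℝ} (hAR : A ⊆ closedBall 0 R) {z : ℂ} (hz : z ∉ closedBall 0 (R + 1)) :
    fderiv ℝ (velocity k A) z 1 + Complex.I * fderiv ℝ (velocity k A) z Complex.I = 0 := by
  rw [hk.dbar_velocity_eq hA]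
  refine setIntegral_eq_zero_of_forall_eq_zero fun ζ hζ => hk.dbar_eq_zero hδ ?_
  have h1 : ‖ζ‖ ≤ R := by simpa using hAR hζ
  have h2 : R + 1 < ‖z‖ := by simpa using hz
  linarith [norm_sub_norm_le z ζ]

/-- The Beurling transform is an isometry: the `L²` norms of `∂` and `∂̄` of the velocity agree, and
the latter is bounded in terms of the support. -/
lemma integral_norm_sq_d_velocity_le (hk : IsRegularizedCauchyKernel C δ k) (hδ : 0 < δ)
    (hδ1 : δ ≤ 1) (hA : IsCompact A) {R : ℝ} (hR : 0 ≤ R) (hAR : A ⊆ closedBall 0 R) :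
    Integrable (fun z => ‖fderiv ℝ (velocity k A) z 1 -
        Complex.I * fderiv ℝ (velocity k A) z Complex.I‖ ^ 2) ∧
      ∫ z, ‖fderiv ℝ (velocity k A) z 1 -
        Complex.I * fderiv ℝ (velocity k A) z Complex.I‖ ^ 2 ≤
        (2 * Real.pi * C) ^ 2 * volume.real (closedBall (0 : ℂ) (R + 1)) := by
  obtain ⟨hJ, hJ0⟩ := hk.integral_jacobian_velocity hδ1 hA hR hAR
  simp_rw [hk.velocity_fderiv_apply hA] at hJ hJ0
  set p := fun z => fderiv ℝ (velocity k A) z 1 with hp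
  set q := fun z => fderiv ℝ (velocity k A) z Complex.I with hq
  have hpc : Continuous p := hk.continuous_fderiv_velocity_apply hA 1
  have hqc : Continuous q := hk.continuous_fderiv_velocity_apply hA Complex.I
  have hQ0 : ∀ z, z ∉ closedBall 0 (R + 1) → ‖p z + Complex.I * q z‖ ^ 2 = 0 := fun z hz => by
    rw [hp, hq, hk.dbar_velocity_eq_zero hδ hδ1 hA hAR hz]
    simp
  have hQc : Continuous fun z => ‖p z + Complex.I * q z‖ ^ 2 := by fun_prop
  have hQ : Integrable fun z => ‖p z + Complex.I * q z‖ ^ 2 :=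
    hQc.integrable_of_hasCompactSupport
      (HasCompactSupport.intro (isCompact_closedBall 0 (R + 1)) hQ0)
  -- The two squares differ by four times the Jacobian, whose integral is zero.
  have hPQ : ∀ z, ‖p z - Complex.I * q z‖ ^ 2 =
      ‖p z + Complex.I * q z‖ ^ 2 + 4 * imConjMul (p z) (q z) := fun z => by
    rw [four_mul_imConjMul]; ring
  change Integrable (fun z => ‖p z - Complex.I * q z‖ ^ 2) ∧
    ∫ z, ‖p z - Complex.I * q z‖ ^ 2 ≤ _
  simp_rw [hPQ]
  refine ⟨hQ.add (hJ.const_mul 4), ?_⟩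
  rw [integral_add hQ (hJ.const_mul 4), integral_const_mul, hJ0, mul_zero, add_zero,
    ← setIntegral_eq_integral_of_forall_compl_eq_zero hQ0]
  refine (le_abs_self _).trans ?_
  rw [← Real.norm_eq_abs]
  refine norm_setIntegral_le_of_norm_le_const measure_closedBall_lt_top fun z _ => ?_
  rw [norm_pow, norm_norm]
  gcongr
  exact hk.norm_dbar_velocity_le hδ hA z

/-- One step along the velocity field diminishes the area of `A` by at most a multiple of the step
size. -/
lemma volume_image_add_smul_velocity_ge (hk : IsRegularizedCauchyKernel C δ k) (hδ : 0 < δ)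
    (hδ1 : δ ≤ 1) (hA : IsCompact A) {R : ℝ} (hR : 0 ≤ R) (hAR : A ⊆ closedBall 0 R) {τ : ℝ}
    (hτ : 0 ≤ τ) (hτ1 : τ ≤ 1) (hinj : Function.Injective fun z => z + τ • velocity k A z) :
    volume.real A - τ * ((1 + 2 * (2 * Real.pi * C) ^ 2) * volume.real (closedBall (0 : ℂ) (R + 1)))
      ≤ volume.real ((fun z => z + τ • velocity k A z) '' A) := by
  obtain ⟨hP, hPle⟩ := hk.integral_norm_sq_d_velocity_le hδ hδ1 hA hR hAR
  set L := fderiv ℝ (velocity k A) with hL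
  set M := 2 * Real.pi * C with hM
  set P := fun z => ‖L z 1 - Complex.I * L z Complex.I‖ ^ 2 with hPdef
  set V := volume.real (closedBall (0 : ℂ) (R + 1))
  have hfin : volume (closedBall (0 : ℂ) (R + 1)) < ⊤ := measure_closedBall_lt_top
  have hAV : volume.real A ≤ V :=
    measureReal_mono (hAR.trans (closedBall_subset_closedBall (by linarith))) hfin.ne
  have hderiv : ∀ z ∈ A, HasFDerivWithinAt (fun z => z + τ • velocity k A z)
      (ContinuousLinearMap.id ℝ ℂ + τ • L z) A z := fun z _ =>
    ((hasFDerivAt_id z).add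
      ((hk.hasFDerivAt_velocity hA z).differentiableAt.hasFDerivAt.const_smul τ)).hasFDerivWithinAt
  have hdet : Continuous fun z => (ContinuousLinearMap.id ℝ ℂ + τ • L z).det := by
    have h1 : Continuous fun z => L z 1 := hk.continuous_fderiv_velocity_apply hA 1
    have h2 : Continuous fun z => L z Complex.I := hk.continuous_fderiv_velocity_apply hA Complex.I
    simp_rw [det_id_add_smul, imConjMul_apply]
    fun_prop
  have himg := integral_image_eq_integral_abs_det_fderiv_smul volume hA.measurableSet hderiv
    hinj.injOn (fun _ => (1 : ℝ))
  simp only [integral_const, MeasurableSet.univ, measureReal_restrict_apply, univ_inter,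
    smul_eq_mul, mul_one] at himg
  rw [himg]
  have hc : ∀ c : ℝ, IntegrableOn (fun _ : ℂ => c) A := fun c =>
    integrableOn_const hA.measure_lt_top.ne
  have hi' : IntegrableOn (fun z => 1 + M ^ 2 + P z) A := (hc (1 + M ^ 2)).add hP.integrableOn
  have hi : IntegrableOn (fun z => 1 - τ * (1 + M ^ 2 + P z)) A := (hc 1).sub (hi'.const_mul τ)
  -- The integral of `P` contributes a second `M ^ 2 * V`, whence the factor `1 + 2 M ^ 2`.
  calc _ ≤ volume.real A - τ * ((1 + M ^ 2) * volume.real A + ∫ z in A, P z) := by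
        gcongr
        have h1 : ∫ z in A, P z ≤ ∫ z, P z :=
          setIntegral_le_integral hP (ae_of_all _ fun z => sq_nonneg _)
        have h2 : (1 + M ^ 2) * volume.real A ≤ (1 + M ^ 2) * V := by gcongr
        linarith
    _ = ∫ z in A, (1 - τ * (1 + M ^ 2 + P z)) := by
        rw [integral_sub (hc 1) (hi'.const_mul τ),
          integral_const_mul, integral_add (hc (1 + M ^ 2)) hP.integrableOn]
        simp only [integral_const, MeasurableSet.univ, measureReal_restrict_apply, univ_inter,
          smul_eq_mul, mul_one]
        ring
    _ ≤ ∫ z in A, |(ContinuousLinearMap.id ℝ ℂ + τ • L z).det| := by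
        refine integral_mono hi (hdet.abs.continuousOn.integrableOn_compact hA) fun z => ?_
        exact (le_det_id_add_smul (L z) hτ hτ1 (hk.norm_dbar_velocity_le hδ hA z)).trans
          (le_abs_self _)

end IsRegularizedCauchyKernel

/-! ### Euler steps and approximately conformal maps -/

/-- Multiplicative stability of `logWeight` under a perturbation of size `c * r * logWeight r`. -/
lemma logWeight_le_of_abs_sub_le {r s c : ℝ} (hr : 0 < r) (hc : c ≤ 1 / 2)
    (h1 : |s - r| ≤ c * (r * logWeight r)) (h2 : |s - r| ≤ r / 2) :
    0 < s ∧ logWeight s ≤ (1 + 2 * c) * logWeight r ∧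
      logWeight r ≤ (1 + 2 * c) * logWeight s := by
  obtain ⟨h1a, h1b⟩ := abs_le.1 h1
  obtain ⟨h2a, h2b⟩ := abs_le.1 h2
  have hs : 0 < s := by linarith
  have hY := one_le_logWeight r
  have hc0 : 0 ≤ c := by
    have := (abs_nonneg _).trans h1
    by_contra h
    have : c * (r * logWeight r) < 0 := mul_neg_of_neg_of_pos (by linarith) (by positivity)
    linarith
  set x := c * logWeight r with hx
  have hx0 : 0 ≤ x := by positivity
  have hq : Real.log (s / r) = Real.log s - Real.log r := Real.log_div hs.ne' hr.ne'
  have hlow : Real.log r - 2 * x ≤ Real.log s := by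
    have h := Real.one_sub_inv_le_log_of_pos (div_pos hs hr)
    rw [hq, inv_div] at h
    have : r / s - 1 ≤ 2 * x := by
      rw [div_sub_one hs.ne', div_le_iff₀ hs]
      nlinarith
    linarith
  have hupp : Real.log s ≤ Real.log r + x := by
    have h := Real.log_le_sub_one_of_pos (div_pos hs hr)
    rw [hq] at h
    have : s / r - 1 ≤ x := by
      rw [div_sub_one hr.ne', div_le_iff₀ hr]
      nlinarith
    linarith
  have hYs : logWeight s ≤ logWeight r + 2 * x := by
    unfold logWeight
    have : max 0 (-Real.log s) ≤ max 0 (-Real.log r) + 2 * x :=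
      max_le (by positivity) (by linarith [le_max_right 0 (-Real.log r)])
    linarith
  have hYr : logWeight r ≤ logWeight s + x := by
    unfold logWeight
    have : max 0 (-Real.log r) ≤ max 0 (-Real.log s) + x :=
      max_le (by positivity) (by linarith [le_max_right 0 (-Real.log s)])
    linarith
  refine ⟨hs, by rw [hx] at hYs; linarith, ?_⟩
  have h3 : logWeight r * (1 - c) ≤ logWeight s := by rw [hx] at hYr; linarith
  nlinarith [mul_le_mul_of_nonneg_left h3 (by linarith : 0 ≤ 1 + 2 * c),
    mul_nonneg hc0 (by linarith : (0 : ℝ) ≤ 1 - 2 * c)]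

lemma surjective_add_of_lipschitzWith {u : ℂ → ℂ} {L : NNReal} (hL : L < 1)
    (hu : LipschitzWith L u) : Function.Surjective fun z => z + u z := by
  intro w
  have hc : ContractingWith L (fun z => w - u z) := by
    refine ⟨hL, LipschitzWith.of_dist_le_mul fun x y => ?_⟩
    rw [dist_sub_left]
    exact hu.dist_le_mul x y
  refine ⟨hc.fixedPoint, ?_⟩
  have h := hc.fixedPoint_isFixedPt
  change w - u hc.fixedPoint = hc.fixedPoint at h
  change hc.fixedPoint + u hc.fixedPoint = w
  nth_rw 1 [← h]
  ring

/-- An upper bound for the area of the sets transported inside the disc of radius `R`. -/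
noncomputable def areaBound (R : ℝ) : ℝ := volume.real (closedBall (0 : ℂ) (R + 1))

/-- An upper bound for the velocity. -/
noncomputable def speedBound (R : ℝ) : ℝ := areaBound R + 2 * Real.pi

/-- The constant in the log-Lipschitz estimate of the velocity. -/
noncomputable def logLipschitzBound (C R : ℝ) : ℝ := 2 * Real.exp 1 * C * speedBound R

/-- An upper bound for the rate of loss of area. -/
noncomputable def lossBound (C R : ℝ) : ℝ := (1 + 2 * (2 * Real.pi * C) ^ 2) * areaBound R

lemma areaBound_nonneg (R : ℝ) : 0 ≤ areaBound R := measureReal_nonneg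

lemma speedBound_nonneg (R : ℝ) : 0 ≤ speedBound R :=
  add_nonneg (areaBound_nonneg R) (by positivity)

lemma logLipschitzBound_nonneg {C : ℝ} (hC : 0 ≤ C) (R : ℝ) : 0 ≤ logLipschitzBound C R :=
  mul_nonneg (by positivity) (speedBound_nonneg R)

lemma lossBound_nonneg (C R : ℝ) : 0 ≤ lossBound C R :=
  mul_nonneg (by positivity) (areaBound_nonneg R)

lemma volume_real_le_areaBound {A : Set ℂ} {R : ℝ} (hAR : A ⊆ closedBall 0 R) :
    volume.real A ≤ areaBound R :=
  measureReal_mono (hAR.trans (closedBall_subset_closedBall (by linarith)))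
    measure_closedBall_lt_top.ne

/-- A surjective continuous self-map of the plane that moves points by at most `d`, distorts
`logWeight` of distances by a factor at most `κ`, is holomorphic at points that are sufficiently
far from `E` in terms of `δ`, moves far away points `z` by at least `a / ‖z‖`, and maps `E` to a
set of area at least `m`. -/
structure IsApproxConformal (E : Set ℂ) (δ K ρ κ d a m : ℝ) (F : ℂ → ℂ) : Prop where
  continuous : Continuous F
  surjective : Function.Surjective F
  norm_sub_le : ∀ z, ‖F z - z‖ ≤ d
  injective : Function.Injective F
  logWeight_le : ∀ z w, z ≠ w → logWeight ‖F z - F w‖ ≤ κ * logWeight ‖z - w‖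
  le_logWeight : ∀ z w, z ≠ w → logWeight ‖z - w‖ ≤ κ * logWeight ‖F z - F w‖
  differentiableAt : ∀ z, z ∉ E → (∀ ζ ∈ E, K * logWeight ‖z - ζ‖ < logWeight δ) →
    DifferentiableAt ℂ F z
  le_re : ∀ z, ρ ≤ ‖z‖ → a ≤ (z * (F z - z)).re
  le_volume : m ≤ volume.real (F '' E)

lemma isApproxConformal_id (E : Set ℂ) (δ K ρ : ℝ) :
    IsApproxConformal E δ K ρ 1 0 0 (volume.real E) id where
  continuous := continuous_id
  surjective := Function.surjective_id
  norm_sub_le z := by simp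
  injective := Function.injective_id
  logWeight_le z w _ := by simp
  le_logWeight z w _ := by simp
  differentiableAt z _ _ := differentiableAt_id
  le_re z _ := by simp
  le_volume := by simp

/-- One Euler step of the transport of `E` by its regularized Cauchy transform. -/
lemma IsApproxConformal.step {E : Set ℂ} {δ K ρ κ d a m : ℝ} {F : ℂ → ℂ}
    (hF : IsApproxConformal E δ K ρ κ d a m F) {C : ℝ} {k : ℂ → ℂ}
    (hk : IsRegularizedCauchyKernel C δ k) (hC : 0 ≤ C) (hδ : 0 < δ) (hδ1 : δ ≤ 1)
    (hE : IsCompact E) {R : ℝ} (hR : 1 ≤ R) (hER : E ⊆ closedBall 0 (R - 1)) (hd : d ≤ 1)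
    (hκ0 : 0 ≤ κ) (hκ : κ ≤ K) {τ b : ℝ} (hτ : 0 ≤ τ) (hτ1 : τ ≤ 1)
    (hτL : τ * (areaBound R * (C / δ ^ 2)) ≤ 1 / 2) (hτω : τ * logLipschitzBound C R ≤ 1 / 2)
    (hρ : R + 2 ≤ ρ) (hb : b ≤ m - (1 + R) / (ρ - 1 - R) * areaBound R) :
    IsApproxConformal E δ K ρ ((1 + 2 * (τ * logLipschitzBound C R)) * κ)
      (d + τ * speedBound R) (a + τ * b) (m - τ * lossBound C R)
      (fun z => F z + τ • velocity k (F '' E) (F z)) := by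
  set A := F '' E with hAdef
  have hA : IsCompact A := hE.image hF.continuous
  have hAR : A ⊆ closedBall 0 R := by
    rintro _ ⟨z, hz, rfl⟩
    have h1 : ‖z‖ ≤ R - 1 := by simpa using hER hz
    have h2 : ‖F z‖ ≤ ‖F z - z‖ + ‖z‖ := by simpa using norm_add_le (F z - z) z
    have h3 := hF.norm_sub_le z
    simp only [mem_closedBall, dist_zero_right]
    linarith
  have hAV := volume_real_le_areaBound hAR
  set G := fun z => z + τ • velocity k A z with hG
  have hlip := hk.lipschitzWith_velocity hC hA hAV
  have hlip' : ∀ z w, ‖τ • velocity k A z - τ • velocity k A w‖ ≤ ‖z - w‖ / 2 := fun z w => by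
    have h := hlip.dist_le_mul z w
    rw [Real.coe_toNNReal _ (mul_nonneg (areaBound_nonneg R) (by positivity)), dist_eq_norm,
      dist_eq_norm] at h
    rw [← smul_sub, norm_smul, Real.norm_of_nonneg hτ]
    calc _ ≤ τ * (areaBound R * (C / δ ^ 2) * ‖z - w‖) := by gcongr
      _ = τ * (areaBound R * (C / δ ^ 2)) * ‖z - w‖ := by ring
      _ ≤ 1 / 2 * ‖z - w‖ := by gcongr
      _ = _ := by ring
  have hω : ∀ z w, z ≠ w → 0 < ‖G z - G w‖ ∧
      logWeight ‖G z - G w‖ ≤ (1 + 2 * (τ * logLipschitzBound C R)) * logWeight ‖z - w‖ ∧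
      logWeight ‖z - w‖ ≤ (1 + 2 * (τ * logLipschitzBound C R)) * logWeight ‖G z - G w‖ := by
    intro z w hzw
    have hr : 0 < ‖z - w‖ := norm_pos_iff.2 (sub_ne_zero.2 hzw)
    have hsub : |‖G z - G w‖ - ‖z - w‖| ≤ ‖τ • velocity k A z - τ • velocity k A w‖ := by
      refine (abs_norm_sub_norm_le _ _).trans_eq (congrArg _ ?_)
      simp only [hG]
      ring
    refine logWeight_le_of_abs_sub_le hr hτω (hsub.trans ?_) (hsub.trans (hlip' z w))
    rw [← smul_sub, norm_smul, Real.norm_of_nonneg hτ, mul_assoc]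
    gcongr
    refine (hk.norm_velocity_sub_le hC hA hzw).trans ?_
    rw [logLipschitzBound, speedBound]
    have := logWeight_pos ‖z - w‖
    gcongr
  have hGinj : Function.Injective G := fun z w h => by
    by_contra hne
    simpa [h] using (hω z w hne).1
  have hGsurj : Function.Surjective G := by
    refine surjective_add_of_lipschitzWith (L := 1 / 2) (by norm_num)
      (LipschitzWith.of_dist_le_mul fun z w => ?_)
    rw [dist_eq_norm, dist_eq_norm]
    refine (hlip' z w).trans_eq ?_
    push_cast
    ring
  have hκ1 : 0 ≤ 1 + 2 * (τ * logLipschitzBound C R) := by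
    have := mul_nonneg hτ (logLipschitzBound_nonneg hC R)
    positivity
  change IsApproxConformal E δ K ρ _ _ _ _ (G ∘ F)
  refine ⟨?_, hGsurj.comp hF.surjective, fun z => ?_, hGinj.comp hF.injective, fun z w hzw => ?_,
    fun z w hzw => ?_, fun z hzE hz => ?_, fun z hz => ?_, ?_⟩
  · exact (continuous_id.add (hlip.continuous.const_smul τ)).comp hF.continuous
  · calc ‖G (F z) - z‖ = ‖(F z - z) + τ • velocity k A (F z)‖ := by
          simp only [hG]; congr 1; ring
      _ ≤ ‖F z - z‖ + ‖τ • velocity k A (F z)‖ := norm_add_le _ _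
      _ ≤ d + τ * speedBound R := by
          rw [norm_smul, Real.norm_of_nonneg hτ]
          gcongr
          · exact hF.norm_sub_le z
          · refine (hk.norm_velocity_le hA _).trans ?_
            rw [speedBound]
            gcongr
  · refine (hω _ _ (hF.injective.ne hzw)).2.1.trans ?_
    rw [mul_assoc]
    exact mul_le_mul_of_nonneg_left (hF.logWeight_le z w hzw) hκ1
  · refine (hF.le_logWeight z w hzw).trans ?_
    calc κ * logWeight ‖F z - F w‖ ≤ κ * ((1 + 2 * (τ * logLipschitzBound C R)) *
          logWeight ‖G (F z) - G (F w)‖) :=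
          mul_le_mul_of_nonneg_left (hω _ _ (hF.injective.ne hzw)).2.2 hκ0
      _ = _ := by rw [Function.comp, Function.comp]; ring
  · have h1 : DifferentiableAt ℂ F z := hF.differentiableAt z hzE hz
    have h2 : DifferentiableAt ℂ (velocity k A) (F z) := by
      refine hk.differentiableAt_velocity hδ hA ?_
      rintro _ ⟨ζ, hζ, rfl⟩
      have hne : z ≠ ζ := fun h => hzE (h ▸ hζ)
      -- If `F z` were within `δ` of `F ζ`, then `logWeight δ ≤ κ * logWeight ‖z - ζ‖`, against the
      -- assumed separation of `z` from `E`, since `κ ≤ K`.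
      by_contra! hle
      have h3 : logWeight δ ≤ logWeight ‖F z - F ζ‖ :=
        logWeight_anti (norm_pos_iff.2 (sub_ne_zero.2 (hF.injective.ne hne))) hle
      have h4 := hF.logWeight_le z ζ hne
      have h5 := hz ζ hζ
      have h6 : κ * logWeight ‖z - ζ‖ ≤ K * logWeight ‖z - ζ‖ :=
        mul_le_mul_of_nonneg_right hκ (logWeight_pos _).le
      linarith
    have h3 : DifferentiableAt ℂ G (F z) := differentiableAt_id.add (h2.const_smul τ)
    exact h3.comp z h1
  · have h1 := hF.le_re z hz
    have hfar := hk.norm_mul_velocity_sub_le hδ1 hA hAR ((hF.norm_sub_le z).trans hd)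
      (hρ.trans hz)
    have h2 := (abs_le.1 ((Complex.abs_re_le_norm _).trans hfar)).1
    rw [Complex.sub_re, Complex.ofReal_re] at h2
    have h3 : (1 + R) / (‖z‖ - 1 - R) * volume.real A ≤ (1 + R) / (ρ - 1 - R) * areaBound R := by
      have : 0 < ρ - 1 - R := by linarith
      gcongr
    have h4 := hF.le_volume
    have h5 : (z * (G (F z) - z)).re =
        (z * (F z - z)).re + τ * (z * velocity k A (F z)).re := by
      rw [← Complex.re_ofReal_mul, ← Complex.add_re]
      simp only [hG, Complex.real_smul]
      congr 1
      ring
    rw [Function.comp, h5]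
    have h6 : τ * b ≤ τ * (z * velocity k A (F z)).re :=
      mul_le_mul_of_nonneg_left (by linarith) hτ
    linarith
  · rw [image_comp]
    have h := hk.volume_image_add_smul_velocity_ge hδ hδ1 hA (by linarith) hAR hτ hτ1 hGinj
    have h2 := hF.le_volume
    rw [lossBound, areaBound]
    linarith

lemma exp_neg_logWeight_le {s : ℝ} (hs : 0 < s) : Real.exp (-logWeight s) ≤ s := by
  calc Real.exp (-logWeight s) ≤ Real.exp (Real.log s) := by
        gcongr
        unfold logWeight
        linarith [le_max_right 0 (-Real.log s)]
    _ = s := Real.exp_log hs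

namespace IsApproxConformal

variable {E : Set ℂ} {δ K ρ κ d a m : ℝ} {F : ℂ → ℂ}

lemma mono (hF : IsApproxConformal E δ K ρ κ d a m F) {κ' d' a' m' : ℝ} (hκ : κ ≤ κ')
    (hd : d ≤ d') (ha : a' ≤ a) (hm : m' ≤ m) : IsApproxConformal E δ K ρ κ' d' a' m' F where
  continuous := hF.continuous
  surjective := hF.surjective
  norm_sub_le z := (hF.norm_sub_le z).trans hd
  injective := hF.injective
  logWeight_le z w h := (hF.logWeight_le z w h).trans
    (mul_le_mul_of_nonneg_right hκ (logWeight_pos _).le)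
  le_logWeight z w h := (hF.le_logWeight z w h).trans
    (mul_le_mul_of_nonneg_right hκ (logWeight_pos _).le)
  differentiableAt := hF.differentiableAt
  le_re z hz := ha.trans (hF.le_re z hz)
  le_volume := hm.trans hF.le_volume

/-- As `exp (-logWeight r) = min 1 r / e`, this is a lower Hölder bound with exponent `κ`. -/
lemma exp_le_norm_sub (hF : IsApproxConformal E δ K ρ κ d a m F) {z w : ℂ} (hzw : z ≠ w) :
    Real.exp (-(κ * logWeight ‖z - w‖)) ≤ ‖F z - F w‖ := by
  refine le_trans ?_ (exp_neg_logWeight_le (norm_pos_iff.2 (sub_ne_zero.2 (hF.injective.ne hzw))))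
  gcongr
  exact hF.logWeight_le z w hzw

lemma norm_sub_lt (hF : IsApproxConformal E δ K ρ κ d a m F) (hκ : 0 ≤ κ) {ε : ℝ} (hε : 0 < ε)
    {z w : ℂ} (h : ‖z - w‖ < Real.exp (-(κ * logWeight ε))) : ‖F z - F w‖ < ε := by
  rcases eq_or_ne z w with rfl | hzw
  · simpa using hε
  by_contra! hle
  have h1 := exp_neg_logWeight_le (norm_pos_iff.2 (sub_ne_zero.2 hzw))
  have h2 : Real.exp (-(κ * logWeight ε)) ≤ Real.exp (-logWeight ‖z - w‖) := by
    gcongr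
    exact (hF.le_logWeight z w hzw).trans (by gcongr; exact logWeight_anti hε hle)
  linarith

end IsApproxConformal

lemma exists_pos_mul_le_of_pos {c b : ℝ} (hc : 0 ≤ c) (hb : 0 < b) :
    ∃ T : ℝ, 0 < T ∧ T * c ≤ b ∧ T ≤ b := by
  have h : 0 < c + 1 := by linarith
  refine ⟨b / (c + 1), by positivity, ?_, div_le_self hb.le (by linarith)⟩
  rw [div_mul_eq_mul_div, div_le_iff₀ h]
  nlinarith

/-- Approximate solutions: almost conformal homeomorphisms with uniform bounds. -/
theorem exists_isApproxConformal {E : Set ℂ} (hE : IsCompact E) (harea : 0 < volume.real E) :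
    ∃ ρ a : ℝ, 0 < a ∧ ∀ δ : ℝ, 0 < δ → δ ≤ 1 →
      ∃ F : ℂ → ℂ, IsApproxConformal E δ (3 / 2) ρ (3 / 2) 1 a 0 F := by
  obtain ⟨C, hC, hker⟩ := exists_isRegularizedCauchyKernel
  obtain ⟨R, hR, hER⟩ : ∃ R : ℝ, 1 ≤ R ∧ E ⊆ closedBall 0 (R - 1) := by
    obtain ⟨r, hr⟩ := hE.isBounded.subset_closedBall 0
    exact ⟨max r 0 + 1, by linarith [le_max_right r 0],
      hr.trans (closedBall_subset_closedBall (by linarith [le_max_left r 0]))⟩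
  set μ := volume.real E
  set V := areaBound R
  have hV : 0 ≤ V := areaBound_nonneg R
  have hS := speedBound_nonneg R
  have hLl := logLipschitzBound_nonneg hC R
  have hLo := lossBound_nonneg C R
  -- Beyond this radius the far-field error is at most `μ / 4`. The area stays at least `μ / 2`, so
  -- each step gains at least `τ * (μ / 4)`.
  set ρ := R + 2 + 4 * (1 + R) * V / μ with hρ
  have hρ2 : R + 2 ≤ ρ := by
    have : 0 ≤ 4 * (1 + R) * V / μ := by positivity
    linarith
  have hfar : (1 + R) / (ρ - 1 - R) * V ≤ μ / 4 := by
    rw [div_mul_eq_mul_div, div_le_iff₀ (by linarith)]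
    have : μ / 4 * (ρ - 1 - R) = μ / 4 + (1 + R) * V := by
      rw [hρ]; field_simp; ring
    linarith
  have hlog : 0 < Real.log (3 / 2) := Real.log_pos (by norm_num)
  -- The total time `T` is chosen before `δ`: displacement at most `1`, area loss at most `μ / 2`,
  -- and final Hölder exponent at most `3 / 2`.
  obtain ⟨T, hT, hTc, hT1⟩ := exists_pos_mul_le_of_pos
    (c := speedBound R + lossBound C R + 2 * logLipschitzBound C R)
    (b := min 1 (min (μ / 2) (Real.log (3 / 2)))) (by positivity) (by positivity)
  have hTb1 := hTc.trans (min_le_left _ _)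
  have hTb2 := hTc.trans ((min_le_right _ _).trans (min_le_left _ _))
  have hTb3 := hTc.trans ((min_le_right _ _).trans (min_le_right _ _))
  replace hT1 := hT1.trans (min_le_left _ _)
  have p1 := mul_nonneg hT.le hS
  have p2 := mul_nonneg hT.le hLo
  have p3 := mul_nonneg hT.le hLl
  have hTS : T * speedBound R ≤ 1 := by linarith
  have hTLo : T * lossBound C R ≤ μ / 2 := by linarith
  have hTLl : 2 * (T * logLipschitzBound C R) ≤ Real.log (3 / 2) := by linarith
  refine ⟨ρ, T * (μ / 4), by positivity, fun δ hδ hδ1 => ?_⟩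
  obtain ⟨k, hk⟩ := hker δ hδ
  -- The number of steps depends on `δ`, as the Lipschitz constant of the velocity does; each step
  -- must be a perturbation of the identity by a contraction.
  obtain ⟨N, hN⟩ := exists_nat_gt
    (2 * T * (V * (C / δ ^ 2) + logLipschitzBound C R) + 1)
  have hq : 0 ≤ V * (C / δ ^ 2) := by positivity
  have hN1 : (1 : ℝ) ≤ N := by
    have : 0 ≤ 2 * T * (V * (C / δ ^ 2) + logLipschitzBound C R) := by positivity
    linarith
  have hN0 : (0 : ℝ) < N := by linarith
  set τ := T / N with hτdef
  have hτ : 0 ≤ τ := by positivity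
  have hNτ : N * τ = T := by rw [hτdef]; field_simp
  have hτ1 : τ ≤ 1 := (div_le_self hT.le hN1).trans hT1
  have hτq : τ * (V * (C / δ ^ 2)) ≤ 1 / 2 := by
    rw [hτdef, div_mul_eq_mul_div, div_le_iff₀ hN0]
    linarith
  have hτω : τ * logLipschitzBound C R ≤ 1 / 2 := by
    have := mul_nonneg hT.le hq
    rw [hτdef, div_mul_eq_mul_div, div_le_iff₀ hN0]
    linarith
  set c := τ * logLipschitzBound C R with hc
  have hc0 : 0 ≤ c := by positivity
  have hpow : ∀ j : ℕ, j ≤ N → (1 + 2 * c) ^ j ≤ 3 / 2 := fun j hj => by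
    calc (1 + 2 * c) ^ j ≤ (1 + 2 * c) ^ N := pow_le_pow_right₀ (by linarith) hj
      _ ≤ Real.exp (2 * c) ^ N := by
          gcongr
          linarith [Real.add_one_le_exp (2 * c)]
      _ = Real.exp (2 * (T * logLipschitzBound C R)) := by
          rw [← Real.exp_nat_mul, ← hNτ, hc]
          congr 1
          ring
      _ ≤ 3 / 2 := by rwa [← Real.le_log_iff_exp_le (by norm_num)]
  have main : ∀ j : ℕ, j ≤ N → ∃ F : ℂ → ℂ, IsApproxConformal E δ (3 / 2) ρ ((1 + 2 * c) ^ j)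
      (j * τ * speedBound R) (j * τ * (μ / 4)) (μ - j * τ * lossBound C R) F := by
    intro j
    induction j with
    | zero =>
      intro _
      exact ⟨id, by simpa using isApproxConformal_id E δ (3 / 2) ρ⟩
    | succ j ih =>
      intro hj
      obtain ⟨F, hF⟩ := ih (by omega)
      have hjT : j * τ ≤ T := by
        rw [← hNτ]
        gcongr
        omega
      have h1 : j * τ * speedBound R ≤ T * speedBound R := by gcongr
      have h2 : j * τ * lossBound C R ≤ T * lossBound C R := by gcongr
      refine ⟨_, (hF.step hk hC hδ hδ1 hE hR hER (by linarith) (by positivity)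
        (hpow j (by omega)) hτ hτ1 hτq hτω hρ2 (b := μ / 4) (by linarith)).mono ?_ ?_ ?_ ?_⟩
      · rw [pow_succ, mul_comm]
      · push_cast; linarith
      · push_cast; linarith
      · push_cast; linarith
  obtain ⟨F, hF⟩ := main N le_rfl
  rw [hNτ] at hF
  exact ⟨F, hF.mono (hpow N le_rfl) hTS le_rfl (by linarith)⟩

/-! ### Two obstructions: critical points and Möbius maps -/

/-- At a critical point `‖f w - f z‖` is `O(‖w - z‖²)`, which a lower Hölder bound of exponent `κ <
2` forbids. The points `z + exp (-t)` with `t → ∞` exhibit the contradiction, as there `logWeight`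
equals `1 + t`. -/
lemma deriv_ne_zero_of_exp_le {f : ℂ → ℂ} {z : ℂ} {κ : ℝ} (hκ : κ < 2)
    (hf : ∀ᶠ w in 𝓝 z, DifferentiableAt ℂ f w)
    (h : ∀ w, w ≠ z → Real.exp (-(κ * logWeight ‖w - z‖)) ≤ ‖f w - f z‖) : deriv f z ≠ 0 := by
  intro h0
  have hs : {w | DifferentiableAt ℂ f w} ∈ 𝓝 z := hf
  have hd : DifferentiableOn ℂ (dslope f z) {w | DifferentiableAt ℂ f w} :=
    (Complex.differentiableOn_dslope hs).2 fun w hw => DifferentiableAt.differentiableWithinAt hw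
  have hO := (hd.differentiableAt hs).isBigO_sub
  rw [dslope_same, h0] at hO
  obtain ⟨c, hc⟩ := hO.bound
  have ht : Tendsto (fun t : ℝ => z + (Real.exp (-t) : ℂ)) atTop (𝓝 z) := by
    have h1 : Tendsto (fun t : ℝ => ((Real.exp (-t) : ℝ) : ℂ)) atTop (𝓝 0) := by
      rw [← Complex.ofReal_zero]
      exact (Complex.continuous_ofReal.tendsto 0).comp Real.tendsto_exp_neg_atTop_nhds_zero
    simpa using tendsto_const_nhds.add h1
  have hlim : Tendsto (fun t : ℝ => Real.exp ((2 - κ) * t - κ)) atTop atTop :=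
    Real.tendsto_exp_atTop.comp (tendsto_atTop_add_const_right _ _
      (tendsto_id.const_mul_atTop (by linarith)))
  obtain ⟨t, ht1, ht2, ht3⟩ := ((ht.eventually hc).and
    ((eventually_ge_atTop 0).and (hlim.eventually_gt_atTop c))).exists
  set w := z + (Real.exp (-t) : ℂ) with hw
  have hwz : w - z = (Real.exp (-t) : ℂ) := by rw [hw]; ring
  have hn : ‖w - z‖ = Real.exp (-t) := by
    rw [hwz, Complex.norm_real, Real.norm_of_nonneg (Real.exp_pos _).le]
  have hne : w ≠ z := by
    rw [← sub_ne_zero, ← norm_pos_iff, hn]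
    exact Real.exp_pos _
  have h1 := h w hne
  rw [← sub_smul_dslope f z w, norm_smul, hn, logWeight, Real.log_exp, neg_neg,
    max_eq_right ht2] at h1
  rw [sub_zero, hn] at ht1
  have h2 : Real.exp (-(κ * (1 + t))) ≤ Real.exp (-t) * (c * Real.exp (-t)) :=
    h1.trans (by gcongr)
  have h3 : Real.exp ((2 - κ) * t - κ) ≤ c := by
    have : Real.exp ((2 - κ) * t - κ) = Real.exp (-(κ * (1 + t))) * Real.exp t * Real.exp t := by
      rw [← Real.exp_add, ← Real.exp_add]; ring_nf
    rw [this]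
    calc _ ≤ Real.exp (-t) * (c * Real.exp (-t)) * Real.exp t * Real.exp t := by gcongr
      _ = c * (Real.exp (-t) * Real.exp t) * (Real.exp (-t) * Real.exp t) := by ring
      _ = c := by rw [← Real.exp_add]; simp
  linarith

/-- Finite values on the whole plane exclude a pole, so the map would be affine. Then `z (f z - z)`
has only a quadratic and a linear term, and its values at `x, -x, ix, -ix` sum to zero instead of
having real part at least `4a`. -/
lemma not_isMobius_of_le_re {f : ℂ → ℂ} {ρ a : ℝ} (ha : 0 < a)
    (h : ∀ z, ρ ≤ ‖z‖ → a ≤ (z * (f z - z)).re) : ¬ IsMobius f := by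
  classical
  rintro ⟨g, hg⟩
  have hne : ∀ z : ℂ, g.1 1 0 * z + g.1 1 1 ≠ 0 := fun z h0 => by
    have := hg z
    rw [OnePoint.smul_some_eq_ite, if_pos h0] at this
    exact OnePoint.coe_ne_infty _ this
  have hc : g.1 1 0 = 0 := by
    by_contra hc
    exact hne (-g.1 1 1 / g.1 1 0) (by field_simp; ring)
  have hf : ∀ z : ℂ, f z = (g.1 0 0 * z + g.1 0 1) / g.1 1 1 := fun z => by
    have := hg z
    rw [OnePoint.smul_some_eq_ite, if_neg (hne z), OnePoint.coe_eq_coe, hc, zero_mul,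
      zero_add] at this
    exact this
  have hx : ρ ≤ ‖((|ρ| : ℝ) : ℂ)‖ := by simpa using le_abs_self ρ
  set x : ℂ := ((|ρ| : ℝ) : ℂ)
  have h1 := h x hx
  have h2 := h (-x) (by simpa using hx)
  have h3 := h (Complex.I * x) (by simpa using hx)
  have h4 := h (-(Complex.I * x)) (by simpa using hx)
  have hsum : x * (f x - x) + -x * (f (-x) - -x) +
      Complex.I * x * (f (Complex.I * x) - Complex.I * x) +
      -(Complex.I * x) * (f (-(Complex.I * x)) - -(Complex.I * x)) = 0 := by
    rw [hf, hf, hf, hf]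
    ring_nf
    rw [Complex.I_sq]
    ring
  have := congrArg Complex.re hsum
  simp only [Complex.add_re, Complex.zero_re] at this
  linarith

/-! ### Passage to the limit along an ultrafilter -/

section Limit

variable {E : Set ℂ} {K ρ κ a m : ℝ} {δ : ℕ → ℝ} {F : ℕ → ℂ → ℂ} {f : ℂ → ℂ}
  {l : Filter ℕ}

lemma exists_tendsto_of_isApproxConformal (l : Ultrafilter ℕ)
    (hF : ∀ n, IsApproxConformal E (δ n) K ρ κ 1 a m (F n)) :
    ∃ f : ℂ → ℂ, ∀ z, Tendsto (fun n => F n z) l (𝓝 (f z)) := by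
  have h : ∀ z, ∃ x, Tendsto (fun n => F n z) l (𝓝 x) := fun z => by
    obtain ⟨x, -, hx⟩ := (isCompact_closedBall z 1).ultrafilter_le_nhds (l.map fun n => F n z)
      (tendsto_principal.2 (Eventually.of_forall fun n => by
        simpa [dist_eq_norm] using (hF n).norm_sub_le z))
    exact ⟨x, hx⟩
  exact ⟨fun z => (h z).choose, fun z => (h z).choose_spec⟩

lemma norm_sub_le_of_tendsto [l.NeBot] (hκ : 0 ≤ κ)
    (hF : ∀ n, IsApproxConformal E (δ n) K ρ κ 1 a m (F n))
    (hf : ∀ z, Tendsto (fun n => F n z) l (𝓝 (f z))) {ε : ℝ} (hε : 0 < ε) {z w : ℂ}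
    (h : ‖z - w‖ < Real.exp (-(κ * logWeight ε))) : ‖f z - f w‖ ≤ ε :=
  le_of_tendsto ((hf z).sub (hf w)).norm
    (Eventually.of_forall fun n => ((hF n).norm_sub_lt hκ hε h).le)

lemma exp_le_norm_sub_of_tendsto [l.NeBot]
    (hF : ∀ n, IsApproxConformal E (δ n) K ρ κ 1 a m (F n))
    (hf : ∀ z, Tendsto (fun n => F n z) l (𝓝 (f z))) {z w : ℂ} (hzw : z ≠ w) :
    Real.exp (-(κ * logWeight ‖z - w‖)) ≤ ‖f z - f w‖ :=
  ge_of_tendsto ((hf z).sub (hf w)).norm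
    (Eventually.of_forall fun n => (hF n).exp_le_norm_sub hzw)

lemma surjective_of_tendsto (l : Ultrafilter ℕ) (hκ : 0 ≤ κ)
    (hF : ∀ n, IsApproxConformal E (δ n) K ρ κ 1 a m (F n))
    (hf : ∀ z, Tendsto (fun n => F n z) l (𝓝 (f z))) : Function.Surjective f := by
  intro w
  -- The preimages of `w` under the `F n` stay within distance `1` of `w`; their limit is a preimage
  -- under `f` by equicontinuity.
  choose p hp using fun n => (hF n).surjective w
  obtain ⟨z, -, hz⟩ := (isCompact_closedBall w 1).ultrafilter_le_nhds (l.map p) (by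
    refine tendsto_principal.2 (Eventually.of_forall fun n => ?_)
    have := (hF n).norm_sub_le (p n)
    rwa [hp, ← dist_eq_norm, dist_comm] at this)
  replace hz : Tendsto p l (𝓝 z) := hz
  refine ⟨z, tendsto_nhds_unique (hf z) ?_⟩
  rw [Metric.tendsto_nhds]
  intro ε hε
  filter_upwards [Metric.tendsto_nhds.1 hz _ (Real.exp_pos (-(κ * logWeight ε)))] with n hn
  rw [dist_comm, dist_eq_norm] at hn
  have := (hF n).norm_sub_lt hκ hε hn
  rwa [hp, ← dist_eq_norm] at this

/-- The modulus of continuity common to all `F n` upgrades pointwise to locally uniform convergence,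
which is what lets holomorphy survive. -/
lemma tendstoLocallyUniformlyOn_of_tendsto [l.NeBot] (hκ : 0 ≤ κ)
    (hF : ∀ n, IsApproxConformal E (δ n) K ρ κ 1 a m (F n))
    (hf : ∀ z, Tendsto (fun n => F n z) l (𝓝 (f z))) (s : Set ℂ) :
    TendstoLocallyUniformlyOn F f l s := by
  rw [Metric.tendstoLocallyUniformlyOn_iff]
  intro ε hε z _
  have hε3 : 0 < ε / 3 := by positivity
  refine ⟨ball z (Real.exp (-(κ * logWeight (ε / 3)))),
    mem_nhdsWithin_of_mem_nhds (ball_mem_nhds _ (Real.exp_pos _)), ?_⟩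
  filter_upwards [Metric.tendsto_nhds.1 (hf z) _ hε3] with n hn w hw
  rw [mem_ball, dist_eq_norm] at hw
  have h1 := norm_sub_le_of_tendsto hκ hF hf hε3 hw
  have h2 := (hF n).norm_sub_lt hκ hε3 hw
  rw [← dist_eq_norm] at h1 h2
  calc dist (f w) (F n w) ≤ dist (f w) (f z) + dist (f z) (F n z) + dist (F n z) (F n w) :=
        dist_triangle4 _ _ _ _
    _ < ε := by rw [dist_comm (f z), dist_comm (F n z) (F n w)]; linarith

lemma tendsto_logWeight_atTop : Tendsto logWeight (𝓝[>] 0) atTop := by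
  refine tendsto_atTop_mono (f := fun r => -Real.log r) (fun r => ?_)
    (tendsto_neg_atBot_atTop.comp Real.tendsto_log_nhdsGT_zero)
  unfold logWeight
  linarith [le_max_right 0 (-Real.log r)]

lemma eventually_differentiableAt_of_tendsto [l.NeBot] (hκ : 0 ≤ κ) (hK : 0 ≤ K)
    (hE : IsClosed E) (hδ : Tendsto δ l (𝓝[>] 0))
    (hF : ∀ n, IsApproxConformal E (δ n) K ρ κ 1 a m (F n))
    (hf : ∀ z, Tendsto (fun n => F n z) l (𝓝 (f z))) {z : ℂ} (hz : z ∉ E) :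
    ∀ᶠ w in 𝓝 z, DifferentiableAt ℂ f w := by
  obtain ⟨r, hr, hrE⟩ := Metric.isOpen_iff.1 hE.isOpen_compl z hz
  have hr2 : 0 < r / 2 := by positivity
  have hfar : ∀ w ∈ ball z (r / 2), ∀ ζ ∈ E, r / 2 ≤ ‖w - ζ‖ := fun w hw ζ hζ => by
    have h1 : r ≤ dist ζ z := not_lt.1 fun h => hrE h hζ
    have h2 : dist w z < r / 2 := hw
    rw [← dist_eq_norm]
    linarith [dist_triangle_left ζ z w]
  -- On this disc `logWeight` of the distance to `E` is bounded, whereas `logWeight (δ n)` tends to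
  -- infinity.
  have hev : ∀ᶠ n in l, DifferentiableOn ℂ (F n) (ball z (r / 2)) := by
    filter_upwards [(tendsto_logWeight_atTop.comp hδ).eventually_gt_atTop
      (K * logWeight (r / 2))] with n hn w hw
    refine ((hF n).differentiableAt w (hrE (ball_subset_ball (by linarith) hw))
      fun ζ hζ => lt_of_le_of_lt ?_ hn).differentiableWithinAt
    gcongr
    exact logWeight_anti hr2 (hfar w hw ζ hζ)
  have hd := (tendstoLocallyUniformlyOn_of_tendsto hκ hF hf (ball z (r / 2))).differentiableOn
    hev isOpen_ball
  filter_upwards [ball_mem_nhds z hr2] with w hw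
  exact hd.differentiableAt (isOpen_ball.mem_nhds hw)

/-- The limit of approximately conformal maps is a homeomorphism. -/
lemma exists_homeomorph_of_tendsto (l : Ultrafilter ℕ) (hκ : 0 ≤ κ)
    (hF : ∀ n, IsApproxConformal E (δ n) K ρ κ 1 a m (F n))
    (hf : ∀ z, Tendsto (fun n => F n z) l (𝓝 (f z))) : ∃ e : ℂ ≃ₜ ℂ, ⇑e = f := by
  have hlow : ∀ z w, z ≠ w → Real.exp (-(κ * logWeight ‖z - w‖)) ≤ ‖f z - f w‖ :=
    fun z w hzw => exp_le_norm_sub_of_tendsto hF hf hzw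
  have hinj : Function.Injective f := fun z w h => by
    by_contra hne
    have := hlow z w hne
    rw [h, sub_self, norm_zero] at this
    exact (Real.exp_pos _).not_ge this
  have hcont : Continuous f := by
    refine Metric.continuous_iff.2 fun z ε hε => ⟨_, Real.exp_pos (-(κ * logWeight (ε / 2))),
      fun w hw => ?_⟩
    rw [dist_eq_norm] at hw ⊢
    linarith [norm_sub_le_of_tendsto hκ hF hf (half_pos hε) hw]
  let e := Equiv.ofBijective f ⟨hinj, surjective_of_tendsto l hκ hF hf⟩
  -- The lower Hölder bound for `f` is a modulus of continuity for its inverse.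
  have hinv : Continuous e.symm := by
    refine Metric.continuous_iff.2 fun z ε hε => ⟨_, Real.exp_pos (-(κ * logWeight ε)),
      fun w hw => ?_⟩
    obtain ⟨z, rfl⟩ := e.surjective z
    obtain ⟨w, rfl⟩ := e.surjective w
    rw [e.symm_apply_apply, e.symm_apply_apply, dist_eq_norm]
    rw [dist_eq_norm] at hw
    by_contra! hle
    have hne : w ≠ z := by
      rintro rfl
      simp at hle
      linarith
    have h1 : Real.exp (-(κ * logWeight ε)) ≤ Real.exp (-(κ * logWeight ‖w - z‖)) := by
      gcongr
      exact logWeight_anti hε hle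
    exact (h1.trans (hlow w z hne)).not_gt hw
  exact ⟨⟨e, hcont, hinv⟩, rfl⟩

end Limit

/-! ### The conformal homeomorphism -/

theorem mainTheorem1 (E : Set ℂ) (hE : IsCompact E) (hdisc : IsTotallyDisconnected E)
    (harea : 0 < MeasureTheory.volume E) :
    ∃ f : ℂ ≃ₜ ℂ, IsConformalOn f Eᶜ ∧ ¬ IsMobius f := by
  obtain ⟨ρ, a, ha, hex⟩ := exists_isApproxConformal hE
    (ENNReal.toReal_pos harea.ne' hE.measure_lt_top.ne)
  choose F hF using fun n : ℕ => hex (1 / ((n : ℝ) + 1)) Nat.one_div_pos_of_nat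
    ((div_le_one (by positivity)).2 (by linarith [n.cast_nonneg (α := ℝ)]))
  let l : Ultrafilter ℕ := hyperfilter ℕ
  have hδ : Tendsto (fun n : ℕ => 1 / ((n : ℝ) + 1)) l (𝓝[>] 0) :=
    tendsto_nhdsWithin_iff.2 ⟨tendsto_one_div_add_atTop_nhds_zero_nat.mono_left
      Nat.hyperfilter_le_atTop, Eventually.of_forall fun n => mem_Ioi.2 Nat.one_div_pos_of_nat⟩
  obtain ⟨f, hf⟩ := exists_tendsto_of_isApproxConformal l hF
  obtain ⟨e, rfl⟩ := exists_homeomorph_of_tendsto l (by norm_num) hF hf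
  have hdiff : ∀ z ∉ E, ∀ᶠ w in 𝓝 z, DifferentiableAt ℂ e w := fun z hz =>
    eventually_differentiableAt_of_tendsto (by norm_num) (by norm_num) hE.isClosed hδ hF hf hz
  refine ⟨e, ⟨fun z hz => (hdiff z hz).self_of_nhds.differentiableWithinAt, e.injective.injOn,
    fun z hz => ?_⟩, not_isMobius_of_le_re (ρ := ρ) ha fun z hz => ?_⟩
  · exact deriv_ne_zero_of_exp_le (by norm_num) (hdiff z hz)
      fun w hw => exp_le_norm_sub_of_tendsto hF hf hw
  · exact ge_of_tendsto ((Complex.continuous_re.tendsto _).comp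
      (((hf z).sub tendsto_const_nhds).const_mul z))
      (Eventually.of_forall fun n => (hF n).le_re z hz)
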